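/- **Setting.** Let $\mathcal T$ be an arborescence with node (agent) set $\mathcal N$, $|\mathcal N|=n\ge 1$, indexed along a topological ordering, with root $r$; let $\mathcal G$ be a set of $m\ge 2$ items. $C(i)$, $P(i)$, $\mathrm{Anc}(i)$ denote the children, the parent and the strict ancestors of $i$. Each leaf $x$ has a matroid rank function $u_x:2^{\mathcal G}\to\mathbb R_+$ with $u_x(\emptyset)=0$ (monotone, submodular, marginal gains in $\{0,1\}$). Add one more child of the root, the node $0$, a leaf with $u_0(S)=|S|$. An allocation $\pi$ gives a bundle $\pi(i)\subseteq\mathcal G$ to each node; $v_x(\pi)=u_x(\pi(x))$ for a leaf $x$ and $v_i(\pi)=\sum_{j\in C(i)}v_j(\pi)$ for an internal node $i\in\mathcal N$ (node $0$ not counted). For each internal node $i$ and $j\in C(i)$ the gain vector $\varphi_i(\pi,j)\in\mathbb R^{b_i}$ is a given, arbitrary function of $v_j(\pi)$. The exchange graph $G(\pi)$ on $\mathcal G$ has an arrow from $g$ to $g'$ if $g\in\pi(x)$, $g'\in\pi(y)$ for leaves $x\ne y$ (node $0$ and pruned leaves included) and $u_x((\pi(x)\setminus\{g\})\cup\{g'\})=u_x(\pi(x))$.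 For a leaf $x$, $F_x(\pi)=\{g\notin\pi(x):u_x(\pi(x)\cup\{g\})-u_x(\pi(x))=1\}$. A transfer path for $x$ is a path $(g_1,\dots,g_t)$ in $G(\pi)$ from $F_x(\pi)$ to $\pi(0)$; the path augmentation gives $g_t$ to the owner of $g_{t-1}$, and so on, and finally $g_1$ to $x$. When a leaf $z$ receives $g$ from a leaf $z'$, the nodes in $\mathrm{Anc}(z)\setminus\mathrm{Anc}(z')$ add $g$ to their bundles and those in $\mathrm{Anc}(z')\setminus\mathrm{Anc}(z)$ remove it. **MGYS.** Start with $\pi(0)=\pi(r)=\mathcal G$ and all other bundles empty. While the tree has a node other than $r$ and $0$: select a leaf $x$ top-down from $r$, moving at each node $i$ to the remaining child $j\neq 0$ of $i$ with lexicographically largest $\varphi_i(\pi,j)$ (ties: least index). If there is a transfer path for $x$, perform the path augmentation along a shortest one; otherwise remove $x$ from the tree and then, upwards, the ancestors that become childless. Return $\pi$. **Cost model.** Reading or writing an array cell, creating or inspecting a cell of an immutable binary tree, and an operation on words or real numbers cost one step up to a constant factor. Bundles are passed to the utility functions as such trees. One evaluation of a leaf's utility takes at most $T_u\ge 1$ steps,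 in addition to the steps that build its argument. A gain vector $\varphi_i(\pi,j)$ is computed from the number $v_j(\pi)$ with one step per coordinate; $b\ge 1$ is an upper bound on (e.g. the maximum of) the dimensions $b_i$. **Theorem.** MGYS can be implemented so that its worst-case running time is $O\big((n+m)(m\,T_u\log m+mn+nb)\big)$. More precisely, there are an explicit implementation in the above cost model and an absolute constant $C$ such that on every instance with $m\ge2$ the implementation starts in the initial state of MGYS, each of its iterations performs exactly one iteration of MGYS, it halts when only $r$ and $0$ are left in the tree, and the total number of steps, initialization included, is at most $C\,(n+m)(m\,T_u\log m+mn+nb)$. -/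

import Mathlib

/-!
# Multilevel General Yankee Swap: problem, algorithm, implementation with step count

1. allocation problems on an arborescence with matroid rank utilities at the leaves;
2. the algorithm MGYS as a transition relation (leaf selection, shortest transfer path,
   path augmentation, pruning);
3. an implementation of MGYS in which every elementary operation is charged.
-/

noncomputable section

namespace MGYS

/-! ## The allocation problem -/

/-- Matroid rank functions on the subsets of `Fin m`. -/
structure IsMatroidRank {m : ℕ} (u : Finset (Fin m) → ℝ) : Prop where
  mono : ∀ S T : Finset (Fin m), S ⊆ T → u S ≤ u T
  submodular : ∀ S T : Finset (Fin m), S ⊆ T → ∀ g, g ∉ T →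
    u (insert g T) - u T ≤ u (insert g S) - u S
  binary : ∀ (S : Finset (Fin m)) (g : Fin m), g ∉ S →
    u (insert g S) - u S = 0 ∨ u (insert g S) - u S = 1

/-- An instance with `n` agents and `m` items.  The agents are the nodes of an arborescence and
are numbered along a topological ordering, so that the root is `0` and each other node has a
parent of smaller index (the value of `parent` at the root is never used). -/
structure Instance (n m : ℕ) [NeZero n] where
  parent : Fin n → Fin n
  parent_lt : ∀ i : Fin n, i ≠ 0 → parent i < i
  /-- utility functions; only those of the leaves matter -/
  u : Fin n → Finset (Fin m) → ℝ
  u_empty : ∀ x : Fin n, (∀ j : Fin n, j ≠ 0 → parent j ≠ x) → u x ∅ = 0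
  u_rank : ∀ x : Fin n, (∀ j : Fin n, j ≠ 0 → parent j ≠ x) → IsMatroidRank (u x)
  /-- dimension of the gain vectors of the children of a node -/
  gainDim : Fin n → ℕ
  /-- `gain i j (v_j(π))` is the gain vector `φ_i(π, j)` of the child `j` of `i`; it may depend
  in any way on the fairness notion of `i` and on the weight of `j` -/
  gain : (i : Fin n) → Fin n → ℝ → (Fin (gainDim i) → ℝ)
  /-- time needed to evaluate the utility function of a leaf on a bundle -/
  evalTime : Fin n → Finset (Fin m) → ℕ

/-- Bundles of all nodes of the arborescence extended by one more child of the root, the node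
`none`, which holds the items that no agent has taken. -/
abbrev Alloc (n m : ℕ) := Option (Fin n) → Finset (Fin m)

/-- A state of the algorithm: the nodes that are still in the tree (apart from `none`, which
always is) and the current allocation. -/
structure Config (n m : ℕ) where
  alive : Finset (Fin n)
  alloc : Alloc n m

/-- Lexicographic dominance of `x` over `y`. -/
def LexDominates {d : ℕ} (x y : Fin d → ℝ) : Prop :=
  ∃ k, (∀ j, j < k → x j = y j) ∧ y k < x k

namespace Instance

variable {n m : ℕ} [NeZero n] (I : Instance n m)

def children (i : Fin n) : Finset (Fin n) := {j | j ≠ 0 ∧ I.parent j = i}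

def IsLeaf (i : Fin n) : Prop := I.children i = ∅

/-- `j` is a (strict) ancestor of a node of the extended arborescence. -/
def IsAncestor (j : Fin n) : Option (Fin n) → Prop
  | none => j = 0
  | some i => Relation.TransGen (fun a c => a ≠ 0 ∧ I.parent a = c) i j

/-- `v_i(π)`: the utility of its own bundle for a leaf, the sum of the utilities of the children
for an internal node. -/
def utility (π : Alloc n m) (i : Fin n) : ℝ :=
  if I.children i = ∅ then I.u i (π (some i))
  else ∑ j : {j // j ∈ I.children i}, utility π j.1
termination_by n - (i : ℕ)
decreasing_by
  have hj := j.2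
  simp only [children, Finset.mem_filter, Finset.mem_univ, true_and] at hj
  have h := I.parent_lt j.1 hj.1
  rw [hj.2, Fin.lt_def] at h
  have := j.1.isLt
  omega

/-! ## The algorithm -/

/-- The gain vector `φ_i(π, j)`. -/
def phi (π : Alloc n m) (i j : Fin n) : Fin (I.gainDim i) → ℝ := I.gain i j (I.utility π j)

/-- The children of `i`, other than `none`, in the current tree. -/
def aliveChildren (A : Finset (Fin n)) (i : Fin n) : Finset (Fin n) := I.children i ∩ A

/-- `j` is the child of `i` with lexicographically maximal gain vector, ties being broken in
favour of the least index. -/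
def IsBestChild (A : Finset (Fin n)) (π : Alloc n m) (i j : Fin n) : Prop :=
  j ∈ I.aliveChildren A i ∧ ∀ j' ∈ I.aliveChildren A i, j' ≠ j →
    LexDominates (I.phi π i j) (I.phi π i j') ∨ (I.phi π i j = I.phi π i j' ∧ j < j')

/-- `SelectsLeaf A π i x`: the top-down selection started at `i` ends in `x`. -/
inductive SelectsLeaf (A : Finset (Fin n)) (π : Alloc n m) : Fin n → Fin n → Prop
  | leaf (i : Fin n) : I.aliveChildren A i = ∅ → SelectsLeaf A π i i
  | descend (i j x : Fin n) :
      I.IsBestChild A π i j → SelectsLeaf A π j x → SelectsLeaf A π i x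

/-- Leaves of the extended arborescence. -/
def IsExtLeaf : Option (Fin n) → Prop
  | none => True
  | some i => I.IsLeaf i

/-- Leaf utilities in the extended arborescence; the node `none` values a bundle at its size. -/
def extU : Option (Fin n) → Finset (Fin m) → ℝ
  | none => fun S => (S.card : ℝ)
  | some i => I.u i

/-- The arrows of the exchange graph of `π`. -/
def Exchange (π : Alloc n m) (g g' : Fin m) : Prop :=
  ∃ x y : Option (Fin n), I.IsExtLeaf x ∧ I.IsExtLeaf y ∧ x ≠ y ∧ g ∈ π x ∧ g' ∈ π y ∧
    I.extU x ((π x \ {g}) ∪ {g'}) = I.extU x (π x)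

/-- `F_x(π)`: the items for which the leaf `x` has marginal gain `1`. -/
def gainItems (π : Alloc n m) (x : Fin n) : Set (Fin m) :=
  {g | g ∉ π (some x) ∧ I.u x (π (some x) ∪ {g}) - I.u x (π (some x)) = 1}

/-- A path in the exchange graph from `F_x(π)` to the bundle of `none`, as its list of items. -/
def IsTransferPath (π : Alloc n m) (x : Fin n) (p : List (Fin m)) : Prop :=
  List.IsChain (I.Exchange π) p ∧ (∃ g ∈ p.head?, g ∈ I.gainItems π x) ∧
    ∃ g ∈ p.getLast?, g ∈ π none

def IsShortestTransferPath (π : Alloc n m) (x : Fin n) (p : List (Fin m)) : Prop :=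
  I.IsTransferPath π x p ∧ ∀ q, I.IsTransferPath π x q → p.length ≤ q.length

open Classical in
/-- `z` receives the item `g` from `z'`, and the bundles of the ancestors are updated. -/
def moveItem (π : Alloc n m) (g : Fin m) (z' z : Option (Fin n)) : Alloc n m := fun w =>
  if w = z ∨ ∃ i, w = some i ∧ I.IsAncestor i z ∧ ¬ I.IsAncestor i z' then insert g (π w)
  else if w = z' ∨ ∃ i, w = some i ∧ I.IsAncestor i z' ∧ ¬ I.IsAncestor i z then (π w).erase g
  else π w

/-- `Augments π z p π'`: along the path `p = (g₁, …, g_t)` the item `g_t` goes to the owner of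
`g_{t-1}`, and so on, until `g₁` goes to `z`; the result is `π'`. -/
inductive Augments (π : Alloc n m) : Option (Fin n) → List (Fin m) → Alloc n m → Prop
  | nil (z : Option (Fin n)) : Augments π z [] π
  | cons (z y : Option (Fin n)) (g : Fin m) (p : List (Fin m)) (π₁ : Alloc n m) :
      I.IsExtLeaf y → g ∈ π y → Augments π y p π₁ → Augments π z (g :: p) (I.moveItem π₁ g y z)

/-- `Prunes i A A'`: starting at `i`, childless nodes are removed upwards.  The root always has
the child `none`. -/
inductive Prunes : Fin n → Finset (Fin n) → Finset (Fin n) → Prop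
  | halt (i : Fin n) (A : Finset (Fin n)) :
      (i = 0 ∨ I.aliveChildren A i ≠ ∅) → Prunes i A A
  | remove (i : Fin n) (A A' : Finset (Fin n)) : i ≠ 0 → I.aliveChildren A i = ∅ →
      Prunes (I.parent i) (A.erase i) A' → Prunes i A A'

/-- Initially all nodes are in the tree, and the root and `none` hold all items. -/
def initialConfig : Config n m where
  alive := Finset.univ
  alloc := fun w => if w = none ∨ w = some 0 then Finset.univ else ∅

/-- One iteration of the outer loop of MGYS. -/
inductive Step : Config n m → Config n m → Prop
  | augment (A : Finset (Fin n)) (π π' : Alloc n m) (x : Fin n) (p : List (Fin m)) :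
      A ≠ {0} → I.SelectsLeaf A π 0 x → I.IsShortestTransferPath π x p →
      I.Augments π (some x) p π' → Step ⟨A, π⟩ ⟨A, π'⟩
  | remove (A A' : Finset (Fin n)) (π : Alloc n m) (x : Fin n) :
      A ≠ {0} → I.SelectsLeaf A π 0 x → (¬ ∃ p, I.IsTransferPath π x p) →
      I.Prunes x A A' → Step ⟨A, π⟩ ⟨A', π⟩

end Instance

/-! ## Computations with a step count -/

/-- A result together with the number of steps spent on it. -/
structure Timed (α : Type) where
  val : α
  time : ℕ

instance : Monad Timed where
  pure a := ⟨a, 0⟩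
  bind c f := ⟨(f c.val).val, c.time + (f c.val).time⟩

/-- Spend `k` steps. -/
def tick (k : ℕ) : Timed Unit := ⟨(), k⟩

/-- Read a cell of an array. -/
def rd {ι α : Type} (a : ι → α) (i : ι) : Timed α := ⟨a i, 1⟩

/-- Write a cell of an array. -/
def wr {ι α : Type} [DecidableEq ι] (a : ι → α) (i : ι) (v : α) : Timed (ι → α) :=
  ⟨Function.update a i v, 1⟩

/-- Immutable binary search trees with items at the leaves: below `node k l r`, the items of
index less than `k` are in `l` and the others in `r`. -/
inductive ItemTree (m : ℕ) where
  | nil : ItemTree m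
  | leaf : Fin m → ItemTree m
  | node : ℕ → ItemTree m → ItemTree m → ItemTree m

namespace ItemTree

variable {m : ℕ}

def items : ItemTree m → Finset (Fin m)
  | nil => ∅
  | leaf g => {g}
  | node _ l r => l.items ∪ r.items

/-- The complete tree of depth `d` over the positions `lo, …, lo + 2 ^ d - 1`, with an item at
each position below `m` if `full` is set, and with no item otherwise. -/
def build (full : Bool) : ℕ → ℕ → Timed (ItemTree m)
  | 0, lo => do
      tick 1
      pure (if h : lo < m then (if full then leaf ⟨lo, h⟩ else nil) else nil)
  | d + 1, lo => do
      tick 1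
      let l ← build full d lo
      let r ← build full d (lo + 2 ^ d)
      pure (node (lo + 2 ^ d) l r)

def erase (g : Fin m) : ItemTree m → Timed (ItemTree m)
  | nil => do
      tick 1
      pure nil
  | leaf h => do
      tick 1
      pure (if h = g then nil else leaf h)
  | node k l r => do
      tick 1
      if (g : ℕ) < k then
        let l' ← erase g l
        pure (node k l' r)
      else
        let r' ← erase g r
        pure (node k l r')

def insert (g : Fin m) : ItemTree m → Timed (ItemTree m)
  | nil => do
      tick 1
      pure (leaf g)
  | leaf _ => do
      tick 1
      pure (leaf g)
  | node k l r => do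
      tick 1
      if (g : ℕ) < k then
        let l' ← insert g l
        pure (node k l' r)
      else
        let r' ← insert g r
        pure (node k l r')

/-- Descend to an item, going left whenever the left subtree passes the test. -/
def find (test : ItemTree m → Timed Bool) : ItemTree m → Timed (Option (Fin m))
  | nil => do
      tick 1
      pure none
  | leaf g => do
      tick 1
      pure (some g)
  | node _ l r => do
      tick 1
      let c ← test l
      if c then find test l else find test r

end ItemTree

/-- Lexicographic comparison, coordinate by coordinate. -/
def lexGreater {d : ℕ} (x y : Fin d → ℝ) : List (Fin d) → Timed Bool
  | [] => do
      tick 1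
      pure false
  | k :: ks => do
      tick 1
      if y k < x k then pure true
      else if x k < y k then pure false
      else lexGreater x y ks

/-! ## The implementation -/

/-- The memory of the implementation. -/
structure State (n m : ℕ) where
  /-- children in the original tree, in increasing order -/
  childList : Fin n → List (Fin n)
  /-- number of children that have not been removed (`none` not counted) -/
  childCount : Fin n → ℕ
  alive : Fin n → Bool
  /-- the leaf that owns an item, or `none` -/
  owner : Fin m → Option (Fin n)
  /-- the bundles of all agents as a matrix of bits -/
  bits : Fin n × Fin m → Bool
  /-- the bundles of the leaves as trees -/
  tree : Fin n → ItemTree m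
  /-- the current utilities of all agents but the root -/
  value : Fin n → ℝ
  /-- the tree of all items -/
  allItems : ItemTree m

/-- The configuration that the memory represents. -/
def State.config {n m : ℕ} (s : State n m) : Config n m where
  alive := {i | s.alive i = true}
  alloc := fun w => match w with
    | none => {g | s.owner g = none}
    | some i => {g | s.bits (i, g) = true}

/-- The memory of one breadth-first search. -/
structure Search (m : ℕ) where
  unvisited : ItemTree m
  pred : Fin m → Option (Fin m)
  next : List (Fin m)

namespace Instance

variable {n m : ℕ} [NeZero n] (I : Instance n m)

/-- Evaluate the utility of the leaf `x` on the union of two bundles. -/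
def evalUtility (x : Fin n) (A B : ItemTree m) : Timed ℝ := do
  tick 1
  let S := (ItemTree.node 0 A B).items
  tick (I.evalTime x S)
  pure (I.u x S)

/-- Compute a gain vector from a utility, with one step for each coordinate. -/
def evalGain (i j : Fin n) (v : ℝ) : Timed (Fin (I.gainDim i) → ℝ) := do
  tick (I.gainDim i + 1)
  pure (I.gain i j v)

/-! ### Selection of a leaf -/

/-- Scan a list of children of `i`; `best` is the best one so far with its gain vector. -/
def bestChild (s : State n m) (i : Fin n) :
    List (Fin n) → Option (Fin n × (Fin (I.gainDim i) → ℝ)) → Timed (Option (Fin n))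
  | [], best => do
      tick 1
      pure (best.map Prod.fst)
  | j :: js, best => do
      tick 1
      let a ← rd s.alive j
      if a then
        let v ← rd s.value j
        let f ← I.evalGain i j v
        match best with
        | none => bestChild s i js (some (j, f))
        | some (j₀, f₀) =>
            let c ← lexGreater f f₀ (List.finRange (I.gainDim i))
            if c then bestChild s i js (some (j, f)) else bestChild s i js (some (j₀, f₀))
      else bestChild s i js best

def selectLeaf (s : State n m) : ℕ → Fin n → Timed (Fin n)
  | 0, i => pure i
  | fuel + 1, i => do
      tick 1
      let c ← rd s.childCount i
      if c = 0 then pure i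
      else
        let l ← rd s.childList i
        let b ← I.bestChild s i l none
        match b with
        | none => pure i
        | some j => selectLeaf s fuel j

/-! ### Search for a shortest transfer path -/

/-- Does adding the bundle `B` to the bundle `A` of `y` give a utility of at least `θ`? -/
def reaches (y : Fin n) (A : ItemTree m) (θ : ℝ) (B : ItemTree m) : Timed Bool := do
  let v ← I.evalUtility y A B
  tick 1
  pure (decide (θ ≤ v))

/-- Visit the unvisited items that give the leaf `y` utility at least `θ` when added to `A`;
stop as soon as one of them belongs to `none`, and return it. -/
def expand (s : State n m) (y : Fin n) (A : ItemTree m) (θ : ℝ) (src : Option (Fin m)) :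
    ℕ → Search m → Timed (Search m × Option (Fin m))
  | 0, q => pure (q, none)
  | fuel + 1, q => do
      tick 1
      let c ← I.reaches y A θ q.unvisited
      if c then
        let r ← q.unvisited.find (I.reaches y A θ)
        match r with
        | none => pure (q, none)
        | some g =>
            let t ← q.unvisited.erase g
            let pr ← wr q.pred g src
            let o ← rd s.owner g
            match o with
            | none => pure (⟨t, pr, q.next⟩, some g)
            | some _ => expand s y A θ src fuel ⟨t, pr, g :: q.next⟩
      else pure (q, none)

/-- Breadth-first search, layer by layer; the list holds what is left of the current layer. -/
def search (s : State n m) :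
    ℕ → List (Fin m) → Search m → Timed (Search m × Option (Fin m))
  | 0, _, q => pure (q, none)
  | fuel + 1, [], q => do
      tick 1
      match q.next with
      | [] => pure (q, none)
      | g :: l => search s fuel (g :: l) { q with next := [] }
  | fuel + 1, g :: l, q => do
      tick 1
      let o ← rd s.owner g
      match o with
      | none => pure (q, none)
      | some y =>
          let B ← rd s.tree y
          let A ← B.erase g
          let θ ← rd s.value y
          let (q', r) ← I.expand s y A θ (some g) (m + 1) q
          match r with
          | some g' => pure (q', some g')
          | none => search s fuel l q'

/-- Read off the path that ends in `g`. -/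
def pathTo (pred : Fin m → Option (Fin m)) : ℕ → Fin m → List (Fin m) → Timed (List (Fin m))
  | 0, _, acc => pure acc
  | fuel + 1, g, acc => do
      tick 1
      let o ← rd pred g
      match o with
      | none => pure (g :: acc)
      | some g' => pathTo pred fuel g' (g :: acc)

/-- A shortest transfer path for the leaf `x`, if there is one. -/
def findPath (s : State n m) (x : Fin n) : Timed (Option (List (Fin m))) := do
  tick (m + 1) -- a fresh array of predecessors
  let B ← rd s.tree x
  let v ← rd s.value x
  let (q, r) ← I.expand s x B (v + 1) none (m + 1) ⟨s.allItems, fun _ => none, []⟩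
  match r with
  | some g =>
      let p ← pathTo q.pred m g []
      pure (some p)
  | none =>
      let (q', r') ← I.search s (2 * m + 2) [] q
      match r' with
      | some g =>
          let p ← pathTo q'.pred m g []
          pure (some p)
      | none => pure none

/-! ### Path augmentation and pruning -/

/-- Set the bits of the item `g` at the node `i` and at its ancestors below the root. -/
def setBits (g : Fin m) (v : Bool) :
    ℕ → Fin n → (Fin n × Fin m → Bool) → Timed (Fin n × Fin m → Bool)
  | 0, _, a => pure a
  | fuel + 1, i, a => do
      tick 1
      if i = 0 then pure a
      else
        let a' ← wr a (i, g) v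
        let p ← rd I.parent i
        setBits g v fuel p a'

/-- Increase the utilities of `i` and of its ancestors below the root by one. -/
def increment : ℕ → Fin n → (Fin n → ℝ) → Timed (Fin n → ℝ)
  | 0, _, a => pure a
  | fuel + 1, i, a => do
      tick 1
      if i = 0 then pure a
      else
        let v ← rd a i
        let a' ← wr a i (v + 1)
        let p ← rd I.parent i
        increment fuel p a'

/-- Take the item `g` away from its owner. -/
def detach (g : Fin m) (o : Option (Fin n)) (s : State n m) : Timed (State n m) := do
  tick 1
  match o with
  | none => pure s
  | some y =>
      let bits ← I.setBits g false n y s.bits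
      let B ← rd s.tree y
      let B' ← B.erase g
      let tree ← wr s.tree y B'
      pure { s with bits := bits, tree := tree }

/-- Give the item `g` to the leaf `x`. -/
def attach (g : Fin m) (x : Fin n) (s : State n m) : Timed (State n m) := do
  tick 1
  let bits ← I.setBits g true n x s.bits
  let B ← rd s.tree x
  let B' ← B.insert g
  let tree ← wr s.tree x B'
  let owner ← wr s.owner g (some x)
  pure { s with bits := bits, tree := tree, owner := owner }

/-- Give the first item of the path to `x`, the second one to the former owner of the first
one, and so on. -/
def reallocate : Fin n → List (Fin m) → State n m → Timed (State n m)
  | _, [], s => do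
      tick 1
      pure s
  | x, g :: p, s => do
      tick 1
      let o ← rd s.owner g
      let s₁ ← I.detach g o s
      let s₂ ← I.attach g x s₁
      match o with
      | none => pure s₂
      | some y => reallocate y p s₂

/-- Remove the childless node `i`, then its parent if that has become childless, and so on. -/
def prune : ℕ → Fin n → State n m → Timed (State n m)
  | 0, _, s => pure s
  | fuel + 1, i, s => do
      tick 1
      let alive ← wr s.alive i false
      let p ← rd I.parent i
      let c ← rd s.childCount p
      let childCount ← wr s.childCount p (c - 1)
      let s' : State n m := { s with alive := alive, childCount := childCount }
      if p = 0 ∨ c - 1 ≠ 0 then pure s' else prune fuel p s'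

/-! ### The whole program -/

/-- One iteration of the outer loop. -/
def iterate (s : State n m) : Timed (State n m) := do
  tick 1
  let x ← I.selectLeaf s n 0
  let r ← I.findPath s x
  match r with
  | some p =>
      let s' ← I.reallocate x p s
      let value ← I.increment n x s'.value
      pure { s' with value := value }
  | none => I.prune n x s

/-- Compute the lists and numbers of children from the parents, for the listed nodes. -/
def buildChildren :
    List (Fin n) → (Fin n → List (Fin n)) → (Fin n → ℕ) →
      Timed ((Fin n → List (Fin n)) × (Fin n → ℕ))
  | [], l, c => do
      tick 1
      pure (l, c)
  | i :: is, l, c => do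
      tick 1
      if i = 0 then buildChildren is l c
      else
        let p ← rd I.parent i
        let lp ← rd l p
        let l' ← wr l p (i :: lp)
        let k ← rd c p
        let c' ← wr c p (k + 1)
        buildChildren is l' c'

/-- Initialization of the memory. -/
def start : Timed (State n m) := do
  tick (2 * n) -- two arrays, of empty lists and of zeros
  tick n -- the nodes in decreasing order
  let (l, c) ← I.buildChildren (List.finRange n).reverse (fun _ => []) (fun _ => 0)
  tick (Nat.clog 2 m + 1) -- the depth of the trees
  let all ← ItemTree.build true (Nat.clog 2 m) 0
  let blank ← ItemTree.build false (Nat.clog 2 m) 0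
  tick (n + m + n * m + n + n) -- the five arrays below
  pure
    { childList := l
      childCount := c
      alive := fun _ => true
      owner := fun _ => none
      bits := fun c => decide (c.1 = 0)
      tree := fun _ => blank
      value := fun _ => 0
      allItems := all }

/-- The test of the outer loop: only the root and `none` are left. -/
def finished (s : State n m) : Timed Bool := do
  tick 1
  let c ← rd s.childCount 0
  pure (decide (c = 0))

/-- The program, stopped when the test of the outer loop has been made `k` times, unless it has
halted before. -/
def exec : ℕ → Timed (State n m)
  | 0 => I.start
  | k + 1 => do
      let s ← exec k
      let f ← finished s
      if f then pure s else I.iterate s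

end Instance

end MGYS

end

noncomputable section

namespace MGYS

/-! ## Matroid rank functions -/

namespace IsMatroidRank

variable {m : ℕ} {u : Finset (Fin m) → ℝ}

/-! The number of unowned items plus the number of nodes in the tree is at most `m + n`. An
augmentation lowers the first summand, a pruning the second, so the loop runs at most `m + n` times
(`exec_spec`, `exists_finished`). It remains to bound one iteration by a multiple of `workload` and
to see that it is a step of MGYS (`Inv.iterate`).

Everything rests on the invariant that the bundle of each leaf is independent: its rank is its
cardinality. If `y` owns `g`, the bundle of `y` without `g` then has rank exactly one below the
stored utility of `y`, and there is an arrow from `g` to another item `h` iff adding `h` restores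
that rank. A matroid rank grows when a set is added iff it grows for a single element of the set
(`le_union_iff`). One evaluation therefore tells whether a whole subtree of unvisited items contains
a neighbour of `g`, and a binary descent finds one with O(log m) evaluations. Breadth-first search
visits each item at most once and meets one failing test on the whole unvisited tree per expanded
item, which gives O(m Tu log m) (`expand_spec`, `search_spec`).

The invariant survives because the path is shortest (`exchanged_indep`, `augOwner_indep`). Let the
exchanges be made from the end of the path. When `y` gives `g` away for `h`, the items that `y` has
already received lie beyond `h` on the path. As there are no shortcuts, they are in the span of the
original bundle of `y` without `g`, and `h` is outside of that span, so the rank is restored. The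
receiver `x` of the first item is treated in the same way, with `F_x` in place of the arrows. Hence
`x` is the only leaf whose utility changes, and adding one along its ancestors keeps all stored
utilities correct (`utility_add_one`).

The other costs: the nodes on a descent have disjoint sets of children, so selection takes O(nb)
(`selectLeaf_time`); moving one item rewrites bits on two paths to the root and two trees
(`reallocate_spec`). Program and algorithm are compared through the array of owners, which
determines the whole allocation (`allocOf`, `moveItem_allocOf`). -/

theorem insert_cases (hu : IsMatroidRank u) (S : Finset (Fin m)) (g : Fin m) :
    u (insert g S) = u S ∨ u (insert g S) = u S + 1 := by
  by_cases hg : g ∈ S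
  · left
    rw [Finset.insert_eq_of_mem hg]
  · rcases hu.binary S g hg with h | h
    · left; linarith
    · right; linarith

/-- By submodularity the marginal gain can only shrink as the set grows, and it is never negative:
spans are monotone. -/
theorem insert_eq_of_subset (hu : IsMatroidRank u) {S T : Finset (Fin m)} (hST : S ⊆ T)
    {g : Fin m} (h : u (insert g S) = u S) : u (insert g T) = u T := by
  by_cases hg : g ∈ T
  · rw [Finset.insert_eq_of_mem hg]
  · have h1 := hu.submodular S T hST g hg
    have h2 := hu.mono T (insert g T) (Finset.subset_insert g T)
    linarith

/-- Adding elements of the span does not change the rank. -/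
theorem union_eq (hu : IsMatroidRank u) {Y X : Finset (Fin m)}
    (h : ∀ x ∈ X, u (insert x Y) = u Y) : u (Y ∪ X) = u Y := by
  induction X using Finset.induction_on with
  | empty => simp
  | insert a X _ ih =>
    rw [Finset.union_insert, ← ih fun x hx => h x (Finset.mem_insert_of_mem hx)]
    exact hu.insert_eq_of_subset Finset.subset_union_left (h a (Finset.mem_insert_self a X))

/-- An element outside of the span of `Y` is outside of the span of every subset of that span. -/
theorem insert_of_span (hu : IsMatroidRank u) {X Y : Finset (Fin m)}
    (h : ∀ x ∈ X, u (insert x Y) = u Y) {b : Fin m} (hb : u (insert b Y) = u Y + 1) :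
    u (insert b X) = u X + 1 := by
  -- Otherwise `X`, hence `Y ∪ X`, spans `b`; but `Y ∪ X` has the rank of `Y`, which contradicts
  -- `hb`.
  refine (hu.insert_cases X b).resolve_left fun hX => ?_
  have h1 := hu.insert_eq_of_subset (Finset.subset_union_right (s₁ := Y)) hX
  have h2 := hu.union_eq h
  have h3 := hu.mono (insert b Y) (insert b (Y ∪ X))
    (Finset.insert_subset_insert _ Finset.subset_union_left)
  linarith

/-- This is the group test behind the search. The threshold lies in the window above `u A` that one
unit of rank crosses, so if no single item of `B` reaches it, all of `B` is in the span of `A`. -/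
theorem le_union_iff (hu : IsMatroidRank u) {A B : Finset (Fin m)} {θ : ℝ} (h1 : u A < θ)
    (h2 : θ ≤ u A + 1) : θ ≤ u (A ∪ B) ↔ ∃ g ∈ B, θ ≤ u (insert g A) := by
  constructor
  · intro h
    by_contra! hc
    have := hu.union_eq (Y := A) (X := B) fun x hx =>
      (hu.insert_cases A x).resolve_right fun h3 => by linarith [hc x hx]
    linarith
  · rintro ⟨g, hg, h⟩
    refine h.trans (hu.mono _ _ ?_)
    intro a ha
    rcases Finset.mem_insert.1 ha with rfl | ha
    · exact Finset.mem_union_right _ hg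
    · exact Finset.mem_union_left _ ha

theorem card_le_add (hu : IsMatroidRank u) (S T : Finset (Fin m)) :
    u (S ∪ T) ≤ u S + T.card := by
  induction T using Finset.induction_on with
  | empty => simp
  | insert a T ha ih =>
    rw [Finset.union_insert, Finset.card_insert_of_notMem ha]
    push_cast
    rcases hu.insert_cases (S ∪ T) a with h | h <;> linarith

/-- Subsets of independent sets are independent. -/
theorem erase_of_indep (hu : IsMatroidRank u) (h0 : u ∅ = 0) {S : Finset (Fin m)}
    (hS : u S = S.card) {g : Fin m} (hg : g ∈ S) : u (S.erase g) = u S - 1 := by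
  have h1 := hu.card_le_add ∅ (S.erase g)
  rw [Finset.empty_union, h0, zero_add, Finset.card_erase_of_mem hg,
    Nat.cast_sub (Finset.card_pos.2 ⟨g, hg⟩)] at h1
  have h2 := hu.insert_cases (S.erase g) g
  rw [Finset.insert_erase hg] at h2
  push_cast at h1
  rcases h2 with h | h <;> linarith

end IsMatroidRank

/-! ## Lexicographic comparison -/

/-- Gives access to the linear order on `Lex`: its transitivity and totality are what the
tie-breaking argument uses. -/
theorem lexDominates_iff {d : ℕ} (x y : Fin d → ℝ) : LexDominates x y ↔ toLex y < toLex x := by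
  constructor
  · rintro ⟨k, h, hk⟩
    exact ⟨k, fun j hj => (h j hj).symm, hk⟩
  · rintro ⟨k, h, hk⟩
    exact ⟨k, fun j hj => (h j hj).symm, hk⟩

/-! ## Timed computations -/

namespace Timed

variable {α β : Type}

@[simp] theorem pure_val (a : α) : (pure a : Timed α).val = a := (rfl)
@[simp] theorem pure_time (a : α) : (pure a : Timed α).time = 0 := (rfl)
@[simp] theorem bind_val (c : Timed α) (f : α → Timed β) : (c >>= f).val = (f c.val).val := (rfl)
@[simp] theorem bind_time (c : Timed α) (f : α → Timed β) :
    (c >>= f).time = c.time + (f c.val).time := (rfl)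

end Timed

@[simp] theorem tick_time (k : ℕ) : (tick k).time = k := (rfl)
@[simp] theorem rd_val {ι α : Type} (a : ι → α) (i : ι) : (rd a i).val = a i := (rfl)
@[simp] theorem rd_time {ι α : Type} (a : ι → α) (i : ι) : (rd a i).time = 1 := (rfl)
@[simp] theorem wr_val {ι α : Type} [DecidableEq ι] (a : ι → α) (i : ι) (v : α) :
    (wr a i v).val = Function.update a i v := (rfl)
@[simp] theorem wr_time {ι α : Type} [DecidableEq ι] (a : ι → α) (i : ι) (v : α) :
    (wr a i v).time = 1 := (rfl)

theorem lexGreater_time {d : ℕ} (x y : Fin d → ℝ) (l : List (Fin d)) :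
    (lexGreater x y l).time ≤ l.length + 1 := by
  induction l with
  | nil => simp [lexGreater]
  | cons k l ih =>
    simp only [lexGreater, Timed.bind_time, tick_time, List.length_cons]
    split_ifs
    · simp
    · simp
    · omega

/-- The recursion consumes the list, so the deciding coordinate is described by a splitting of an
arbitrary list. Only for the sorted list of all coordinates is the prefix the set of smaller
indices. -/
theorem lexGreater_val_iff {d : ℕ} (x y : Fin d → ℝ) (l : List (Fin d)) :
    (lexGreater x y l).val = true ↔
      ∃ l₁ k l₂, l = l₁ ++ k :: l₂ ∧ (∀ j ∈ l₁, x j = y j) ∧ y k < x k := by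
  induction l with
  | nil => simp [lexGreater]
  | cons k l ih =>
    simp only [lexGreater, Timed.bind_val]
    split_ifs with h1 h2
    · simp only [Timed.pure_val, true_iff]
      exact ⟨[], k, l, rfl, by simp, h1⟩
    · simp only [false_iff]
      rintro ⟨l₁, k', l₂, h, he, hk⟩
      cases l₁ with
      | nil =>
        simp only [List.nil_append, List.cons.injEq] at h
        rw [← h.1] at hk
        exact h1 hk
      | cons a l₁ =>
        simp only [List.cons_append, List.cons.injEq] at h
        have := he a (by simp)
        rw [← h.1] at this
        exact h2.ne this
    · rw [ih]
      have hk : x k = y k := le_antisymm (not_lt.1 h1) (not_lt.1 h2)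
      constructor
      · rintro ⟨l₁, k', l₂, rfl, he, hk'⟩
        exact ⟨k :: l₁, k', l₂, rfl, by simpa [hk] using he, hk'⟩
      · rintro ⟨l₁, k', l₂, h, he, hk'⟩
        cases l₁ with
        | nil =>
          simp only [List.nil_append, List.cons.injEq] at h
          rw [← h.1] at hk'
          exact absurd hk' h1
        | cons a l₁ =>
          simp only [List.cons_append, List.cons.injEq] at h
          exact ⟨l₁, k', l₂, h.2, fun j hj => he j (by simp [hj]), hk'⟩

theorem lexGreater_finRange {d : ℕ} (x y : Fin d → ℝ) :
    (lexGreater x y (List.finRange d)).val = true ↔ LexDominates x y := by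
  rw [lexGreater_val_iff]
  have hs := List.pairwise_lt_finRange d
  constructor
  · rintro ⟨l₁, k, l₂, h, he, hk⟩
    refine ⟨k, fun j hj => he j ?_, hk⟩
    rw [h, List.pairwise_append, List.pairwise_cons] at hs
    have : j ∈ l₁ ++ k :: l₂ := h ▸ List.mem_finRange j
    rcases List.mem_append.1 this with h1 | h1
    · exact h1
    · rcases List.mem_cons.1 h1 with rfl | h1
      · exact absurd hj (lt_irrefl _)
      · exact absurd hj (hs.2.1.1 j h1).le.not_gt
  · rintro ⟨k, he, hk⟩
    obtain ⟨l₁, l₂, h⟩ := List.append_of_mem (List.mem_finRange k)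
    refine ⟨l₁, k, l₂, h, fun j hj => he j ?_, hk⟩
    rw [h, List.pairwise_append] at hs
    exact hs.2.2 j hj k (by simp)

/-! ## The arborescence -/

namespace Instance

variable {n m : ℕ} [NeZero n] (I : Instance n m)

theorem mem_children {i j : Fin n} : j ∈ I.children i ↔ j ≠ 0 ∧ I.parent j = i := by
  simp [children]

theorem lt_of_mem_children {i j : Fin n} (h : j ∈ I.children i) : i < j := by
  rw [mem_children] at h
  exact h.2 ▸ I.parent_lt j h.1

/-- `i` is `x` or one of its ancestors. -/
def Up (x i : Fin n) : Prop :=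
  Relation.ReflTransGen (fun a c => a ≠ 0 ∧ I.parent a = c) x i

theorem Up.refl (x : Fin n) : I.Up x x := Relation.ReflTransGen.refl

variable {I} in
theorem Up.le {x i : Fin n} (h : I.Up x i) : i ≤ x := by
  induction h with
  | refl => exact le_rfl
  | tail _ h ih => exact (h.2 ▸ (I.parent_lt _ h.1).le).trans ih

theorem up_zero_iff {i : Fin n} : I.Up 0 i ↔ i = 0 :=
  ⟨fun h => le_antisymm h.le (Fin.zero_le _), fun h => h ▸ Up.refl I 0⟩

theorem up_iff_parent {x i : Fin n} (hx : x ≠ 0) : I.Up x i ↔ i = x ∨ I.Up (I.parent x) i := by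
  constructor
  · intro h
    rcases Relation.ReflTransGen.cases_head h with h | ⟨c, hc, h⟩
    · exact Or.inl h.symm
    · right; rw [hc.2]; exact h
  · rintro (rfl | h)
    · exact Up.refl I _
    · exact Relation.ReflTransGen.head ⟨hx, rfl⟩ h

theorem up_root (x : Fin n) : I.Up x 0 := by
  induction x using WellFoundedLT.induction with
  | _ x ih =>
    by_cases hx : x = 0
    · exact hx ▸ Up.refl I _
    · exact (I.up_iff_parent hx).2 (Or.inr (ih _ (I.parent_lt x hx)))

theorem up_iff_child {x i : Fin n} : I.Up x i ↔ x = i ∨ ∃ j ∈ I.children i, I.Up x j := by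
  constructor
  · intro h
    rcases Relation.ReflTransGen.cases_tail h with h | ⟨c, h, hc⟩
    · exact Or.inl h.symm
    · exact Or.inr ⟨c, I.mem_children.2 hc, h⟩
  · rintro (rfl | ⟨j, hj, h⟩)
    · exact Up.refl I _
    · exact Relation.ReflTransGen.tail h (I.mem_children.1 hj)

/-- The nodes above `x` form a chain, and two distinct children of the same node are incomparable.
Thus a gain at `x` enters the sum at `i` through one summand only. -/
theorem up_child_unique {x i j k : Fin n} (hj : j ∈ I.children i) (hk : k ∈ I.children i)
    (hxj : I.Up x j) (hxk : I.Up x k) : j = k := by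
  have key : ∀ j k : Fin n, j ∈ I.children i → k ∈ I.children i → I.Up j k → j = k := by
    intro j k hj hk h
    have h1 := I.mem_children.1 hj
    rcases (I.up_iff_parent h1.1).1 h with h | h
    · exact h.symm
    · rw [h1.2] at h
      exact absurd (I.lt_of_mem_children hk) h.le.not_gt
  have hu : Relator.RightUnique (fun a c => a ≠ 0 ∧ I.parent a = c) :=
    fun a b c hb hc => hb.2.symm.trans hc.2
  rcases Relation.ReflTransGen.total_of_right_unique hu hxj hxk with h | h
  · exact key j k hj hk h
  · exact (key k j hk hj h).symm

theorem isAncestor_some_iff {i x : Fin n} :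
    I.IsAncestor i (some x) ↔ i ≠ x ∧ I.Up x i := by
  constructor
  · intro h
    have h' : Relation.TransGen (fun a c => a ≠ 0 ∧ I.parent a = c) x i := h
    obtain ⟨c, hc, h1⟩ := Relation.TransGen.head'_iff.1 h'
    have h2 : I.Up c i := h1
    refine ⟨fun e => ?_, h'.to_reflTransGen⟩
    have := h2.le
    rw [← hc.2, e] at this
    exact absurd (I.parent_lt x hc.1) this.not_gt
  · rintro ⟨h1, h2⟩
    exact ((Relation.reflTransGen_iff_eq_or_transGen.1 h2).resolve_left h1)

theorem isLeaf_iff {i : Fin n} : I.IsLeaf i ↔ ∀ j : Fin n, j ≠ 0 → I.parent j ≠ i := by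
  simp [IsLeaf, Finset.eq_empty_iff_forall_notMem, mem_children]

theorem eq_of_up_leaf {x y : Fin n} (hy : I.IsLeaf y) (h : I.Up x y) : x = y := by
  rcases I.up_iff_child.1 h with h | ⟨j, hj, _⟩
  · exact h
  · rw [IsLeaf] at hy
    simp [hy] at hj

theorem rank_of_isLeaf {x : Fin n} (hx : I.IsLeaf x) : IsMatroidRank (I.u x) :=
  I.u_rank x (I.isLeaf_iff.1 hx)

theorem u_empty_of_isLeaf {x : Fin n} (hx : I.IsLeaf x) : I.u x ∅ = 0 :=
  I.u_empty x (I.isLeaf_iff.1 hx)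

theorem utility_leaf (π : Alloc n m) {i : Fin n} (h : I.IsLeaf i) :
    I.utility π i = I.u i (π (some i)) := by
  rw [utility]
  exact if_pos h

theorem utility_internal (π : Alloc n m) {i : Fin n} (h : ¬ I.IsLeaf i) :
    I.utility π i = ∑ j ∈ I.children i, I.utility π j := by
  rw [utility, ← Finset.sum_coe_sort (I.children i) (fun j => I.utility π j)]
  exact if_neg h

open Classical in
/-- If the utility of one leaf grows by one, those of its ancestors grow by one. -/
theorem utility_add_one {π π' : Alloc n m} {x : Fin n}
    (hx : I.IsLeaf x) (hx' : I.u x (π' (some x)) = I.u x (π (some x)) + 1)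
    (hy : ∀ y, I.IsLeaf y → y ≠ x → I.u y (π' (some y)) = I.u y (π (some y))) (i : Fin n) :
    I.utility π' i = I.utility π i + if I.Up x i then 1 else 0 := by
  -- Children have larger indices, so this induction goes from the leaves to the root.
  induction i using WellFoundedGT.induction with
  | _ i ih =>
    by_cases hi : I.IsLeaf i
    · rw [I.utility_leaf π' hi, I.utility_leaf π hi]
      by_cases hix : i = x
      · subst hix
        rw [hx', if_pos (Up.refl I i)]
      · rw [hy i hi hix, if_neg fun h => hix (I.eq_of_up_leaf hi h).symm, add_zero]
    · rw [I.utility_internal π' hi, I.utility_internal π hi,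
        Finset.sum_congr rfl fun j hj => ih j (I.lt_of_mem_children hj), Finset.sum_add_distrib]
      congr 1
      by_cases hu : I.Up x i
      · rw [if_pos hu]
        rcases I.up_iff_child.1 hu with h | ⟨j, hj, h⟩
        · exact absurd (h ▸ hx) hi
        · rw [Finset.sum_eq_single j, if_pos h]
          · intro k hk hkj
            exact if_neg fun hk' => hkj (I.up_child_unique hk hj hk' h)
          · exact fun h' => absurd hj h'
      · rw [if_neg hu]
        exact Finset.sum_eq_zero fun j hj =>
          if_neg fun h => hu (I.up_iff_child.2 (Or.inr ⟨j, hj, h⟩))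

end Instance

/-! ## Trees of items -/

namespace ItemTree

variable {m : ℕ}

/-- The tree has depth `d` everywhere and its leaves hold the positions `lo, …, lo + 2 ^ d - 1`,
each of them with its item or without an item. -/
def WF : ℕ → ℕ → ItemTree m → Prop
  | 0, lo, t => t = nil ∨ ∃ h : lo < m, t = leaf ⟨lo, h⟩
  | d + 1, lo, t => ∃ l r, t = node (lo + 2 ^ d) l r ∧ WF d lo l ∧ WF d (lo + 2 ^ d) r

theorem WF.mem_range {d lo : ℕ} {t : ItemTree m} (h : WF d lo t) {g : Fin m} (hg : g ∈ t.items) :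
    lo ≤ g ∧ (g : ℕ) < lo + 2 ^ d := by
  induction d generalizing lo t with
  | zero =>
    rcases h with rfl | ⟨h, rfl⟩
    · simp [items] at hg
    · simp only [items, Finset.mem_singleton] at hg
      subst hg
      simp
  | succ d ih =>
    obtain ⟨l, r, rfl, hl, hr⟩ := h
    rw [pow_succ]
    rcases Finset.mem_union.1 hg with hg | hg
    · have := ih hl hg
      omega
    · have := ih hr hg
      omega

/-- Erasing empties a position and keeps the shape, so the depth never changes and the time is
exact. A `g` outside of the range only meets a position that does not hold it. -/
theorem WF.erase {d lo : ℕ} {t : ItemTree m} (h : WF d lo t) (g : Fin m) :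
    WF d lo (t.erase g).val ∧ (t.erase g).val.items = t.items.erase g ∧
      (t.erase g).time = d + 1 := by
  induction d generalizing lo t with
  | zero =>
    rcases h with rfl | ⟨h, rfl⟩
    · simp [ItemTree.erase, items, WF]
    · simp only [ItemTree.erase, Timed.bind_val, Timed.pure_val, Timed.bind_time, tick_time,
        Timed.pure_time]
      split_ifs with hg
      · subst hg
        simp [WF, items]
      · refine ⟨Or.inr ⟨h, rfl⟩, ?_, trivial⟩
        rw [Finset.erase_eq_of_notMem]
        simpa [items] using fun e => hg e.symm
  | succ d ih =>
    obtain ⟨l, r, rfl, hl, hr⟩ := h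
    have notMem_r : (g : ℕ) < lo + 2 ^ d → g ∉ r.items := fun hg h =>
      absurd (hr.mem_range h).1 (by omega)
    have notMem_l : ¬ (g : ℕ) < lo + 2 ^ d → g ∉ l.items := fun hg h =>
      absurd (hl.mem_range h).2 (by omega)
    simp only [ItemTree.erase, Timed.bind_val, Timed.bind_time, tick_time]
    split_ifs with hg
    · obtain ⟨h1, h2, h3⟩ := ih hl
      refine ⟨⟨_, _, rfl, h1, hr⟩, ?_, ?_⟩
      · simp only [Timed.bind_val, Timed.pure_val, items, h2, Finset.erase_union_distrib,
          Finset.erase_eq_of_notMem (notMem_r hg)]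
      · simp only [Timed.bind_time, h3, Timed.pure_time]
        omega
    · obtain ⟨h1, h2, h3⟩ := ih hr
      refine ⟨⟨_, _, rfl, hl, h1⟩, ?_, ?_⟩
      · simp only [Timed.bind_val, Timed.pure_val, items, h2, Finset.erase_union_distrib,
          Finset.erase_eq_of_notMem (notMem_l hg)]
      · simp only [Timed.bind_time, h3, Timed.pure_time]
        omega

theorem WF.insert {d lo : ℕ} {t : ItemTree m} (h : WF d lo t) {g : Fin m} (h1 : lo ≤ g)
    (h2 : (g : ℕ) < lo + 2 ^ d) :
    WF d lo (t.insert g).val ∧ (t.insert g).val.items = Insert.insert g t.items ∧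
      (t.insert g).time = d + 1 := by
  induction d generalizing lo t with
  | zero =>
    have hg : (g : ℕ) = lo := by simp at h2; omega
    subst hg
    rcases h with rfl | ⟨h, rfl⟩
    · simp [ItemTree.insert, items, WF]
    · simp [ItemTree.insert, items, WF]
  | succ d ih =>
    obtain ⟨l, r, rfl, hl, hr⟩ := h
    rw [pow_succ] at h2
    simp only [ItemTree.insert, Timed.bind_val, Timed.bind_time, tick_time]
    split_ifs with hg
    · obtain ⟨h1, h2, h3⟩ := ih hl h1 hg
      refine ⟨⟨_, _, rfl, h1, hr⟩, ?_, ?_⟩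
      · simp only [Timed.bind_val, Timed.pure_val, items, h2, Finset.insert_union]
      · simp only [Timed.bind_time, h3, Timed.pure_time]
        omega
    · obtain ⟨h1, h2, h3⟩ := ih hr (not_lt.1 hg) (by omega)
      refine ⟨⟨_, _, rfl, hl, h1⟩, ?_, ?_⟩
      · simp only [Timed.bind_val, Timed.pure_val, items, h2, Finset.union_insert]
      · simp only [Timed.bind_time, h3, Timed.pure_time]
        omega

theorem build_wf (full : Bool) (d lo : ℕ) : WF d lo (build (m := m) full d lo).val := by
  induction d generalizing lo with
  | zero =>
    simp only [build, Timed.bind_val, Timed.pure_val]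
    split_ifs with h1 h2
    · exact Or.inr ⟨h1, rfl⟩
    · exact Or.inl rfl
    · exact Or.inl rfl
  | succ d ih => exact ⟨_, _, rfl, ih _, ih _⟩

theorem build_time (full : Bool) (d lo : ℕ) :
    (build (m := m) full d lo).time + 1 = 2 * 2 ^ d := by
  induction d generalizing lo with
  | zero => rfl
  | succ d ih =>
    have h1 := ih lo
    have h2 := ih (lo + 2 ^ d)
    simp only [build, Timed.bind_time, tick_time, Timed.pure_time]
    rw [pow_succ]
    omega

theorem build_false_items (d lo : ℕ) : (build (m := m) false d lo).val.items = ∅ := by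
  induction d generalizing lo with
  | zero => simp [build, items]
  | succ d ih => simp [build, items, ih]

theorem mem_build_true_items {d lo : ℕ} {g : Fin m} (h1 : lo ≤ g)
    (h2 : (g : ℕ) < lo + 2 ^ d) : g ∈ (build (m := m) true d lo).val.items := by
  induction d generalizing lo with
  | zero =>
    have hg : (g : ℕ) = lo := by simp at h2; omega
    subst hg
    simp [build, items]
  | succ d ih =>
    rw [pow_succ] at h2
    simp only [build, Timed.bind_val, Timed.pure_val, items, Finset.mem_union]
    by_cases h : (g : ℕ) < lo + 2 ^ d
    · exact Or.inl (ih h1 h)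
    · exact Or.inr (ih (not_lt.1 h) (by omega))

/-- When the left subtree fails the test, the witness must be on the right, so one test per level
suffices. -/
theorem find_val {test : ItemTree m → Timed Bool} {ok : Fin m → Prop}
    (htest : ∀ t, (test t).val = true ↔ ∃ g ∈ t.items, ok g) {t : ItemTree m}
    (ht : ∃ g ∈ t.items, ok g) : ∃ g ∈ t.items, ok g ∧ (find test t).val = some g := by
  induction t with
  | nil => simp [items] at ht
  | leaf g =>
    obtain ⟨g', h, h'⟩ := ht
    simp only [items, Finset.mem_singleton] at h
    subst h
    exact ⟨g', by simp [items], h', rfl⟩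
  | node k l r ihl ihr =>
    simp only [find, Timed.bind_val]
    split_ifs with h
    · obtain ⟨g, h1, h2, h3⟩ := ihl ((htest l).1 h)
      exact ⟨g, Finset.mem_union_left _ h1, h2, h3⟩
    · have hr : ∃ g ∈ r.items, ok g := by
        obtain ⟨g, hg, hok⟩ := ht
        rcases Finset.mem_union.1 hg with hg | hg
        · exact absurd ((htest l).2 ⟨g, hg, hok⟩) h
        · exact ⟨g, hg, hok⟩
      obtain ⟨g, h1, h2, h3⟩ := ihr hr
      exact ⟨g, Finset.mem_union_right _ h1, h2, h3⟩

theorem WF.find_time {test : ItemTree m → Timed Bool} {T : ℕ} (htest : ∀ t, (test t).time ≤ T)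
    {d lo : ℕ} {t : ItemTree m} (h : WF d lo t) : (find test t).time ≤ d * (T + 1) + 1 := by
  induction d generalizing lo t with
  | zero =>
    rcases h with rfl | ⟨h, rfl⟩
    · simp [find]
    · simp [find]
  | succ d ih =>
    obtain ⟨l, r, rfl, hl, hr⟩ := h
    have h1 := htest l
    have h2 := ih hl
    have h3 := ih hr
    simp only [find, Timed.bind_time, tick_time]
    rw [Nat.succ_mul]
    split_ifs <;> omega

end ItemTree

namespace Instance

variable {n m : ℕ} [NeZero n] (I : Instance n m)

/-! ## Selection of a leaf -/

/-- `j` beats `j'` as a child of `i`. -/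
def Beats (π : Alloc n m) (i j j' : Fin n) : Prop :=
  LexDominates (I.phi π i j) (I.phi π i j') ∨ (I.phi π i j = I.phi π i j' ∧ j < j')

variable {I} in
theorem Beats.trans {π : Alloc n m} {i j k l : Fin n} (h1 : I.Beats π i j k)
    (h2 : I.Beats π i k l) : I.Beats π i j l := by
  simp only [Beats, lexDominates_iff] at *
  rcases h1 with h1 | ⟨h1, h1'⟩ <;> rcases h2 with h2 | ⟨h2, h2'⟩
  · exact Or.inl (h2.trans h1)
  · exact Or.inl (h2 ▸ h1)
  · exact Or.inl (h1 ▸ h2)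
  · exact Or.inr ⟨h1.trans h2, h1'.trans h2'⟩

/-- By totality of the lexicographic order, the earlier of two children keeps its place unless the
later one is strictly better. -/
theorem beats_of_lt {π : Alloc n m} {i j k : Fin n} (hjk : j < k)
    (h : ¬ LexDominates (I.phi π i k) (I.phi π i j)) : I.Beats π i j k := by
  rw [lexDominates_iff] at h
  rcases (not_lt.1 h).lt_or_eq with h | h
  · exact Or.inl ((lexDominates_iff _ _).2 h)
  · exact Or.inr ⟨(toLex.injective h).symm, hjk⟩

/-- The current best has a smaller index than everything still to be scanned, so the strict
comparison breaks ties correctly. The clause comparing the result with `j₀` lets transitivity cover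
the children already discarded. -/
theorem bestChild_some {s : State n m} {π : Alloc n m} {i : Fin n} {js : List (Fin n)}
    (hs : js.Pairwise (· < ·)) (hv : ∀ j ∈ js, s.value j = I.utility π j) {j₀ : Fin n}
    (h0 : ∀ j ∈ js, j₀ < j) :
    ∃ j, (I.bestChild s i js (some (j₀, I.phi π i j₀))).val = some j ∧
      (j = j₀ ∨ I.Beats π i j j₀) ∧ (j = j₀ ∨ j ∈ js ∧ s.alive j = true) ∧
      ∀ k ∈ js, s.alive k = true → k ≠ j → I.Beats π i j k := by
  induction js generalizing j₀ with
  | nil => exact ⟨j₀, rfl, Or.inl rfl, Or.inl rfl, by simp⟩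
  | cons k js ih =>
    rw [List.pairwise_cons] at hs
    have hv' : ∀ j ∈ js, s.value j = I.utility π j := fun j hj => hv j (by simp [hj])
    simp only [bestChild, Timed.bind_val, rd_val]
    have hf : (I.evalGain i k (s.value k)).val = I.phi π i k := by
      rw [hv k (by simp)]; rfl
    by_cases ha : s.alive k = true
    · simp only [if_pos ha, Timed.bind_val, rd_val, hf]
      split_ifs with hc
      · obtain ⟨j, h1, h2, h3, h4⟩ := ih hs.2 hv' (j₀ := k) hs.1
        have hk : I.Beats π i k j₀ := Or.inl ((lexGreater_finRange _ _).1 hc)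
        have hj0 : I.Beats π i j j₀ := by
          rcases h2 with rfl | h2
          · exact hk
          · exact h2.trans hk
        refine ⟨j, h1, Or.inr hj0, ?_, ?_⟩
        · rcases h3 with rfl | h3
          · exact Or.inr ⟨by simp, ha⟩
          · exact Or.inr ⟨by simp [h3.1], h3.2⟩
        · intro l hl hal hlj
          rcases List.mem_cons.1 hl with rfl | hl
          · exact h2.resolve_left fun e => hlj e.symm
          · exact h4 l hl hal hlj
      · obtain ⟨j, h1, h2, h3, h4⟩ := ih hs.2 hv' (j₀ := j₀) fun j hj => h0 j (by simp [hj])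
        have hk : I.Beats π i j₀ k :=
          I.beats_of_lt (h0 k (by simp)) fun h => hc ((lexGreater_finRange _ _).2 h)
        refine ⟨j, h1, h2, h3.imp_right fun h => ⟨by simp [h.1], h.2⟩, ?_⟩
        intro l hl hal hlj
        rcases List.mem_cons.1 hl with rfl | hl
        · rcases h2 with rfl | h2
          · exact hk
          · exact h2.trans hk
        · exact h4 l hl hal hlj
    · rw [if_neg ha]
      obtain ⟨j, h1, h2, h3, h4⟩ := ih hs.2 hv' (j₀ := j₀) fun j hj => h0 j (by simp [hj])
      refine ⟨j, h1, h2, h3.imp_right fun h => ⟨by simp [h.1], h.2⟩, ?_⟩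
      intro l hl hal hlj
      rcases List.mem_cons.1 hl with rfl | hl
      · exact absurd hal ha
      · exact h4 l hl hal hlj

theorem bestChild_none {s : State n m} {π : Alloc n m} {i : Fin n} {js : List (Fin n)}
    (hs : js.Pairwise (· < ·)) (hv : ∀ j ∈ js, s.value j = I.utility π j)
    (hne : ∃ j ∈ js, s.alive j = true) :
    ∃ j, (I.bestChild s i js none).val = some j ∧ (j ∈ js ∧ s.alive j = true) ∧
      ∀ k ∈ js, s.alive k = true → k ≠ j → I.Beats π i j k := by
  induction js with
  | nil => simp at hne
  | cons k js ih =>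
    rw [List.pairwise_cons] at hs
    have hv' : ∀ j ∈ js, s.value j = I.utility π j := fun j hj => hv j (by simp [hj])
    simp only [bestChild, Timed.bind_val, rd_val]
    have hf : (I.evalGain i k (s.value k)).val = I.phi π i k := by
      rw [hv k (by simp)]; rfl
    split_ifs with ha
    · simp only [Timed.bind_val, rd_val, hf]
      obtain ⟨j, h1, h2, h3, h4⟩ := I.bestChild_some (i := i) hs.2 hv' (j₀ := k) hs.1
      refine ⟨j, h1, ?_, ?_⟩
      · rcases h3 with rfl | h3
        · exact ⟨by simp, ha⟩
        · exact ⟨by simp [h3.1], h3.2⟩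
      · intro l hl hal hlj
        rcases List.mem_cons.1 hl with rfl | hl
        · exact h2.resolve_left fun e => hlj e.symm
        · exact h4 l hl hal hlj
    · have hne' : ∃ j ∈ js, s.alive j = true := by
        obtain ⟨j, hj, haj⟩ := hne
        rcases List.mem_cons.1 hj with rfl | hj
        · exact absurd haj ha
        · exact ⟨j, hj, haj⟩
      obtain ⟨j, h1, h2, h3⟩ := ih hs.2 hv' hne'
      refine ⟨j, h1, ⟨by simp [h2.1], h2.2⟩, ?_⟩
      intro l hl hal hlj
      rcases List.mem_cons.1 hl with rfl | hl
      · exact absurd hal ha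
      · exact h3 l hl hal hlj

theorem bestChild_time (s : State n m) (i : Fin n) (js : List (Fin n))
    (best : Option (Fin n × (Fin (I.gainDim i) → ℝ))) :
    (I.bestChild s i js best).time ≤ js.length * (2 * I.gainDim i + 5) + 1 := by
  induction js generalizing best with
  | nil => simp [bestChild]
  | cons k js ih =>
    simp only [bestChild, Timed.bind_time, tick_time, rd_val, rd_time, List.length_cons]
    rw [Nat.succ_mul]
    split_ifs
    · simp only [Timed.bind_time, rd_time, rd_val]
      have he : (I.evalGain i k (s.value k)).time = I.gainDim i + 1 := rfl
      rw [he]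
      cases best with
      | none =>
        have := ih (some (k, (I.evalGain i k (s.value k)).val))
        dsimp only
        omega
      | some b =>
        obtain ⟨j₀, f₀⟩ := b
        simp only [Timed.bind_time]
        have hl := lexGreater_time (I.evalGain i k (s.value k)).val f₀
          (List.finRange (I.gainDim i))
        rw [List.length_finRange] at hl
        have h1 := ih (some (k, (I.evalGain i k (s.value k)).val))
        have h2 := ih (some (j₀, f₀))
        split_ifs <;> omega
    · have := ih best
      omega

/-- Indices increase on the way down, so the bound `n ≤ fuel + i` is preserved and the fuel cannot
run out. -/
theorem selectLeaf_spec {s : State n m} {A : Finset (Fin n)} {π : Alloc n m}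
    (hA : ∀ i, s.alive i = true ↔ i ∈ A)
    (hs : ∀ i, (s.childList i).Pairwise (· < ·)) (hm : ∀ i j, j ∈ s.childList i ↔ j ∈ I.children i)
    (hc : ∀ i, s.childCount i = (I.aliveChildren A i).card)
    (hv : ∀ j, j ≠ 0 → s.value j = I.utility π j) (fuel : ℕ) {i : Fin n} (hi : i ∈ A)
    (hfuel : n ≤ fuel + i) :
    I.SelectsLeaf A π i (I.selectLeaf s fuel i).val ∧ (I.selectLeaf s fuel i).val ∈ A ∧
      I.aliveChildren A (I.selectLeaf s fuel i).val = ∅ ∧ i ≤ (I.selectLeaf s fuel i).val := by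
  induction fuel generalizing i with
  | zero => exact absurd i.isLt (by omega)
  | succ fuel ih =>
    simp only [selectLeaf, Timed.bind_val, rd_val]
    split_ifs with h0
    · rw [hc, Finset.card_eq_zero] at h0
      exact ⟨SelectsLeaf.leaf i h0, hi, h0, le_rfl⟩
    · rw [hc, Finset.card_eq_zero, ← ne_eq, ← Finset.nonempty_iff_ne_empty] at h0
      obtain ⟨k, hk⟩ := h0
      rw [aliveChildren, Finset.mem_inter] at hk
      have hv' : ∀ j ∈ s.childList i, s.value j = I.utility π j := fun j hj =>
        hv j (I.mem_children.1 ((hm i j).1 hj)).1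
      obtain ⟨j, h1, h2, h3⟩ := I.bestChild_none (hs i) hv' ⟨k, (hm i k).2 hk.1, (hA k).2 hk.2⟩
      simp only [Timed.bind_val, rd_val]
      rw [h1]
      have hj : j ∈ I.children i := (hm i j).1 h2.1
      have hlt := I.lt_of_mem_children hj
      obtain ⟨h4, h5, h6, h7⟩ := ih ((hA j).1 h2.2) (by rw [Fin.lt_def] at hlt; omega)
      refine ⟨SelectsLeaf.descend i j _ ⟨?_, ?_⟩ h4, h5, h6, hlt.le.trans h7⟩
      · exact Finset.mem_inter.2 ⟨hj, (hA j).1 h2.2⟩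
      · intro j' hj' hne
        rw [aliveChildren, Finset.mem_inter] at hj'
        exact h3 j' ((hm i j').2 hj'.1) ((hA j').2 hj'.2) hne

theorem bestChild_mem (s : State n m) (i : Fin n) (js : List (Fin n))
    (best : Option (Fin n × (Fin (I.gainDim i) → ℝ))) {j : Fin n}
    (h : (I.bestChild s i js best).val = some j) : (∃ f, best = some (j, f)) ∨ j ∈ js := by
  induction js generalizing best with
  | nil =>
    simp only [bestChild, Timed.bind_val, Timed.pure_val, Option.map_eq_some_iff] at h
    obtain ⟨a, h, rfl⟩ := h
    exact Or.inl ⟨a.2, h⟩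
  | cons k js ih =>
    simp only [bestChild, Timed.bind_val, rd_val] at h
    split_ifs at h
    · simp only [Timed.bind_val, rd_val] at h
      cases best with
      | none =>
        rcases ih _ h with ⟨f, hf⟩ | h
        · simp only [Option.some.injEq, Prod.mk.injEq] at hf
          exact Or.inr (by simp [hf.1])
        · exact Or.inr (by simp [h])
      | some b =>
        obtain ⟨j₀, f₀⟩ := b
        simp only [Timed.bind_val] at h
        split_ifs at h
        · rcases ih _ h with ⟨f, hf⟩ | h
          · simp only [Option.some.injEq, Prod.mk.injEq] at hf
            exact Or.inr (by simp [hf.1])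
          · exact Or.inr (by simp [h])
        · rcases ih _ h with ⟨f, hf⟩ | h
          · simp only [Option.some.injEq, Prod.mk.injEq] at hf
            exact Or.inl ⟨f₀, by simp [hf.1]⟩
          · exact Or.inr (by simp [h])
    · rcases ih _ h with h | h
      · exact Or.inl h
      · exact Or.inr (by simp [h])

/-- The nodes other than the root whose parent is at least `i`. -/
def below (i : Fin n) : Finset (Fin n) := {k | k ≠ 0 ∧ i ≤ I.parent k}

/-- Makes the cost of a descent telescope: the children of `i` have parent `i < j`, so they are not
counted again from `j` on. -/
theorem card_children_add_card_below {i j : Fin n} (h : i < j) :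
    (I.children i).card + (I.below j).card ≤ (I.below i).card := by
  rw [← Finset.card_union_of_disjoint]
  · refine Finset.card_le_card fun k hk => ?_
    simp only [below, Finset.mem_union, mem_children, Finset.mem_filter, Finset.mem_univ,
      true_and] at hk ⊢
    rcases hk with ⟨h1, h2⟩ | ⟨h1, h2⟩
    · exact ⟨h1, h2.ge⟩
    · exact ⟨h1, h.le.trans h2⟩
  · rw [Finset.disjoint_left]
    intro k hk hk'
    simp only [below, mem_children, Finset.mem_filter, Finset.mem_univ, true_and] at hk hk'
    rw [hk.2] at hk'
    exact absurd h hk'.2.not_gt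

theorem selectLeaf_time {s : State n m} {b : ℕ} (hb : 1 ≤ b)
    (hs : ∀ i, (s.childList i).Pairwise (· < ·)) (hm : ∀ i j, j ∈ s.childList i ↔ j ∈ I.children i)
    (hc : ∀ i, s.childCount i ≠ 0 → ¬ I.IsLeaf i) (hd : ∀ i, ¬ I.IsLeaf i → I.gainDim i ≤ b)
    (fuel : ℕ) (i : Fin n) :
    (I.selectLeaf s fuel i).time ≤ (I.below i).card * (13 * b) + 4 := by
  induction fuel generalizing i with
  | zero => simp [selectLeaf]
  | succ fuel ih =>
    simp only [selectLeaf, Timed.bind_time, tick_time, rd_time, rd_val]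
    split_ifs with h0
    · simp only [Timed.pure_time]
      omega
    · simp only [Timed.bind_time, rd_time, rd_val]
      have hleaf := hc i h0
      have hdim := hd i hleaf
      have hlen : (s.childList i).length = (I.children i).card := by
        rw [← List.toFinset_card_of_nodup ((hs i).imp fun h => h.ne)]
        congr 1
        ext j
        simp [hm]
      have hpos : 1 ≤ (I.children i).card :=
        Finset.card_pos.2 (Finset.nonempty_iff_ne_empty.2 hleaf)
      have ht := I.bestChild_time s i (s.childList i) none
      rw [hlen] at ht
      have ht' : (I.children i).card * (2 * I.gainDim i + 5) ≤ (I.children i).card * (7 * b) :=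
        Nat.mul_le_mul_left _ (by omega)
      -- A node that is left downwards has a child, so the fixed cost of the visit is also charged
      -- to its children; hence `13 * b` in place of `7 * b`.
      have hcb : 1 * b ≤ (I.children i).card * b := Nat.mul_le_mul_right b hpos
      cases hbest : (I.bestChild s i (s.childList i) none).val with
      | none =>
        have hle : (I.children i).card ≤ (I.below i).card := by
          refine Finset.card_le_card fun k hk => ?_
          rw [mem_children] at hk
          simp [below, hk.1, hk.2]
        have := Nat.mul_le_mul_right (13 * b) hle
        simp only [Timed.pure_time]
        nlinarith
      | some j =>
        rcases I.bestChild_mem s i _ _ hbest with ⟨f, hf⟩ | hj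
        · simp at hf
        · have h1 := I.card_children_add_card_below (I.lt_of_mem_children ((hm i j).1 hj))
          have h2 := ih j
          have h3 := Nat.mul_le_mul_right (13 * b) h1
          simp only
          nlinarith

end Instance

/-! ## Paths recorded by predecessors -/

/-- `Traces pred g p`: following `pred` from `g` backwards gives the list `p`, which ends in `g`. -/
inductive Traces {m : ℕ} (pred : Fin m → Option (Fin m)) : Fin m → List (Fin m) → Prop
  | root (g : Fin m) : pred g = none → Traces pred g [g]
  | step (g g' : Fin m) (p : List (Fin m)) :
      pred g = some g' → Traces pred g' p → Traces pred g (p ++ [g])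

namespace Traces

variable {m : ℕ} {pred pred' : Fin m → Option (Fin m)} {g : Fin m} {p : List (Fin m)}

theorem congr (h : Traces pred g p) (hp : ∀ e ∈ p, pred' e = pred e) : Traces pred' g p := by
  induction h with
  | root g h => exact root g ((hp g (by simp)).trans h)
  | step g g' p h _ ih =>
    exact step g g' p ((hp g (by simp)).trans h) (ih fun e he => hp e (by simp [he]))

theorem pathTo_val (h : Traces pred g p) {fuel : ℕ} (hf : p.length ≤ fuel)
    (acc : List (Fin m)) : (Instance.pathTo pred fuel g acc).val = p ++ acc := by
  induction h generalizing fuel acc with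
  | root g h =>
    cases fuel with
    | zero => simp at hf
    | succ fuel => simp [Instance.pathTo, h]
  | step g g' p h _ ih =>
    cases fuel with
    | zero => simp at hf
    | succ fuel =>
      simp only [Instance.pathTo, Timed.bind_val, rd_val, h]
      rw [ih (by simpa using hf)]
      simp

end Traces

theorem pathTo_time {m : ℕ} (pred : Fin m → Option (Fin m)) (fuel : ℕ) (g : Fin m)
    (acc : List (Fin m)) : (Instance.pathTo pred fuel g acc).time ≤ 2 * fuel := by
  induction fuel generalizing g acc with
  | zero => simp [Instance.pathTo]
  | succ fuel ih =>
    simp only [Instance.pathTo, Timed.bind_time, tick_time, rd_time, rd_val]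
    cases pred g with
    | none => simp only [Timed.pure_time]; omega
    | some g' =>
      have := ih g' (g :: acc)
      dsimp only
      omega

namespace Instance

variable {n m : ℕ} [NeZero n] (I : Instance n m)

/-! ## Expansion of one item -/

theorem reaches_val_iff {y : Fin n} (hy : I.IsLeaf y) {A : ItemTree m} {θ : ℝ}
    (h1 : I.u y A.items < θ) (h2 : θ ≤ I.u y A.items + 1) (B : ItemTree m) :
    (I.reaches y A θ B).val = true ↔ ∃ g ∈ B.items, θ ≤ I.u y (insert g A.items) := by
  rw [← (I.rank_of_isLeaf hy).le_union_iff h1 h2]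
  simp only [reaches, Timed.bind_val, Timed.pure_val, decide_eq_true_eq]
  -- The items of the joined tree `node 0 A B` are a union by definition: one new cell builds the
  -- argument of the utility function.
  exact Iff.rfl

theorem reaches_time {y : Fin n} {Tu : ℕ} (hT : ∀ S, I.evalTime y S ≤ Tu) (A : ItemTree m)
    (θ : ℝ) (B : ItemTree m) : (I.reaches y A θ B).time ≤ Tu + 2 := by
  have := hT (ItemTree.node 0 A B).items
  simp only [reaches, evalUtility, Timed.bind_time, Timed.pure_time, tick_time]
  omega

/-- The time charged to one visited item. -/
def visitTime (d Tu : ℕ) : ℕ := (d + 1) * (Tu + 4) + 4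

/-- Each visited item pays `visitTime` for its test, descent and erasure; the `+ 1` in the time
bound pays for the last, failing test. In the second alternative the visited items move from
`unvisited` to `next` one by one, and the last clause records that the sum of the two sizes is
constant, which `search_spec` uses as a potential. -/
theorem expand_spec (s : State n m) {y : Fin n} (hy : I.IsLeaf y) {A : ItemTree m} {θ : ℝ}
    (h1 : I.u y A.items < θ) (h2 : θ ≤ I.u y A.items + 1) (src : Option (Fin m)) {d Tu : ℕ}
    (hT : ∀ S, I.evalTime y S ≤ Tu) (fuel : ℕ) (q : Search m) (hq : q.unvisited.WF d 0)
    (hfuel : q.unvisited.items.card < fuel) :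
    (I.expand s y A θ src fuel q).val.1.unvisited.WF d 0 ∧
    ((I.expand s y A θ src fuel q).time +
      visitTime d Tu * (I.expand s y A θ src fuel q).val.1.unvisited.items.card ≤
      visitTime d Tu * (q.unvisited.items.card + 1)) ∧
    ((∃ g ∈ q.unvisited.items, θ ≤ I.u y (insert g A.items) ∧ s.owner g = none ∧
        (I.expand s y A θ src fuel q).val.2 = some g ∧
        (I.expand s y A θ src fuel q).val.1.pred g = src ∧
        ∀ h, h ∉ q.unvisited.items → (I.expand s y A θ src fuel q).val.1.pred h = q.pred h) ∨
      ((I.expand s y A θ src fuel q).val.2 = none ∧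
        (∀ h, h ∈ (I.expand s y A θ src fuel q).val.1.unvisited.items ↔
          h ∈ q.unvisited.items ∧ ¬ θ ≤ I.u y (insert h A.items)) ∧
        (∀ h ∈ q.unvisited.items, θ ≤ I.u y (insert h A.items) →
          (I.expand s y A θ src fuel q).val.1.pred h = src ∧ s.owner h ≠ none) ∧
        (∀ h, h ∉ q.unvisited.items →
          (I.expand s y A θ src fuel q).val.1.pred h = q.pred h) ∧
        (∀ h, h ∈ (I.expand s y A θ src fuel q).val.1.next ↔
          h ∈ q.next ∨ (h ∈ q.unvisited.items ∧ θ ≤ I.u y (insert h A.items))) ∧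
        (I.expand s y A θ src fuel q).val.1.unvisited.items.card +
          (I.expand s y A θ src fuel q).val.1.next.length =
          q.unvisited.items.card + q.next.length)) := by
  induction fuel generalizing q with
  | zero => exact absurd hfuel (Nat.not_lt_zero _)
  | succ fuel ih =>
    have htest := I.reaches_val_iff hy h1 h2
    have htime := I.reaches_time hT A θ
    have htime1 := htime q.unvisited
    have htime2 := hq.find_time htime
    -- One round: a test, a descent, an erasure and three single steps.
    have hK : (Tu + 2) + (d * (Tu + 2 + 1) + 1) + (d + 1) + 3 ≤ visitTime d Tu := by
      rw [visitTime]; nlinarith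
    simp only [expand, Timed.bind_val, Timed.bind_time, tick_time]
    by_cases hc : (I.reaches y A θ q.unvisited).val = true
    · obtain ⟨g, hg, hok, hfind⟩ := ItemTree.find_val htest ((htest _).1 hc)
      obtain ⟨e1, e2, e3⟩ := hq.erase g
      have hcard : (q.unvisited.items.erase g).card + 1 = q.unvisited.items.card := by
        rw [Finset.card_erase_of_mem hg]
        have := Finset.card_pos.2 ⟨g, hg⟩
        omega
      simp only [if_pos hc, Timed.bind_val, Timed.bind_time, hfind, wr_val, wr_time, rd_val,
        rd_time, e3]
      cases ho : s.owner g with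
      | none =>
        simp only [Timed.pure_val, Timed.pure_time, e2]
        refine ⟨e1, ?_, Or.inl ⟨g, hg, hok, ho, rfl, by simp, fun h hh => ?_⟩⟩
        · rw [← hcard]; nlinarith
        · rw [Function.update_of_ne]
          rintro rfl
          exact hh hg
      | some z =>
        simp only
        obtain ⟨i1, i2, i3⟩ := ih ⟨(q.unvisited.erase g).val, Function.update q.pred g src,
          g :: q.next⟩ e1 (by simp only [e2]; omega)
        simp only [e2] at i2 i3
        refine ⟨i1, ?_, ?_⟩
        · rw [hcard] at i2
          nlinarith
        · rcases i3 with ⟨g', hg', j1, j2, j3, j4, j5⟩ | ⟨j1, j2, j3, j4, j5, j6⟩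
          · refine Or.inl ⟨g', Finset.mem_of_mem_erase hg', j1, j2, j3, j4, fun h hh => ?_⟩
            rw [j5 h fun h' => hh (Finset.mem_of_mem_erase h'), Function.update_of_ne]
            rintro rfl
            exact hh hg
          · refine Or.inr ⟨j1, fun h => ?_, fun h hh hok' => ?_, fun h hh => ?_, fun h => ?_, ?_⟩
            · rw [j2, Finset.mem_erase]
              constructor
              · exact fun h => ⟨h.1.2, h.2⟩
              · rintro ⟨a, b⟩
                exact ⟨⟨fun e => b (e ▸ hok), a⟩, b⟩
            · by_cases hhg : h = g
              · subst hhg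
                rw [j4 h (by simp), Function.update_self]
                exact ⟨rfl, by simp [ho]⟩
              · exact j3 h (Finset.mem_erase.2 ⟨hhg, hh⟩) hok'
            · rw [j4 h fun h' => hh (Finset.mem_of_mem_erase h'), Function.update_of_ne]
              rintro rfl
              exact hh hg
            · rw [j5, Finset.mem_erase, List.mem_cons]
              constructor
              · rintro ((rfl | h) | h)
                · exact Or.inr ⟨hg, hok⟩
                · exact Or.inl h
                · exact Or.inr ⟨h.1.2, h.2⟩
              · rintro (h | h)
                · exact Or.inl (Or.inr h)
                · by_cases hhg : ‹Fin m› = g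
                  · exact Or.inl (Or.inl hhg)
                  · exact Or.inr ⟨⟨hhg, h.1⟩, h.2⟩
            · rw [j6, List.length_cons]
              omega
    · simp only [if_neg hc, Timed.pure_val, Timed.pure_time]
      rw [htest] at hc
      push Not at hc
      refine ⟨hq, ?_, Or.inr ⟨trivial, fun h => ?_, fun h hh hok => ?_, fun _ _ => trivial,
        fun h => ?_, trivial⟩⟩
      · rw [Nat.mul_add]
        omega
      · exact ⟨fun hh => ⟨hh, (hc h hh).not_ge⟩, fun hh => hh.1⟩
      · exact absurd hok (hc h hh).not_ge
      · exact ⟨Or.inl, fun h' => h'.resolve_right fun hh => (hc h hh.1).not_ge hh.2⟩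

/-! ## Breadth-first search -/

/-- A path with arrows from `E` that starts in `F`. -/
def IsWalk (E : Fin m → Fin m → Prop) (F : Set (Fin m)) (p : List (Fin m)) : Prop :=
  p.IsChain E ∧ ∃ g ∈ p.head?, g ∈ F

/-- A path to `g` that is recorded by the predecessors and consists of visited items. -/
structure Recorded (E : Fin m → Fin m → Prop) (F : Set (Fin m)) (q : Search m) (g : Fin m)
    (p : List (Fin m)) : Prop where
  traces : Traces q.pred g p
  walk : IsWalk E F p
  last : p.getLast? = some g
  nodup : p.Nodup
  visited : ∀ e ∈ p, e ∉ q.unvisited.items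

/-- The invariant of the breadth-first search: `l` is what is left of the layer `k`. -/
structure SearchInv (E : Fin m → Fin m → Prop) (F : Set (Fin m)) (o : Fin m → Option (Fin n))
    (d k : ℕ) (l : List (Fin m)) (q : Search m) : Prop where
  wf : q.unvisited.WF d 0
  first : ∀ g ∈ F, g ∉ q.unvisited.items
  owned : ∀ g, g ∉ q.unvisited.items → o g ≠ none
  layer : ∀ g ∈ l, ∃ p, Recorded E F q g p ∧ p.length = k
  next : ∀ g ∈ q.next, ∃ p, Recorded E F q g p ∧ p.length = k + 1
  closed : ∀ g, g ∉ q.unvisited.items →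
    g ∈ l ∨ g ∈ q.next ∨ ∀ h, E g h → h ∉ q.unvisited.items
  far : ∀ p, IsWalk E F p → p.length ≤ k → ∀ g ∈ p.getLast?,
    g ∉ q.unvisited.items ∧ g ∉ q.next

/-- What a search returns. -/
def IsSearchResult (E : Fin m → Fin m → Prop) (F : Set (Fin m)) (o : Fin m → Option (Fin n))
    (pred : Fin m → Option (Fin m)) : Option (Fin m) → Prop
  | none => ∀ p, IsWalk E F p → ∀ g ∈ p.getLast?, o g ≠ none
  | some g => ∃ p, Traces pred g p ∧ IsWalk E F p ∧ p.getLast? = some g ∧ p.Nodup ∧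
      o g = none ∧ ∀ p', IsWalk E F p' → (∃ g' ∈ p'.getLast?, o g' = none) → p.length ≤ p'.length

theorem IsWalk.append {E : Fin m → Fin m → Prop} {F : Set (Fin m)} {p : List (Fin m)}
    (h : IsWalk E F p) {g g' : Fin m} (hl : p.getLast? = some g) (hE : E g g') :
    IsWalk E F (p ++ [g']) := by
  obtain ⟨h1, a, ha, haF⟩ := h
  refine ⟨List.isChain_append.2 ⟨h1, by simp, ?_⟩, a, ?_, haF⟩
  · intro x hx y hy
    rw [hl] at hx
    simp only [List.head?_cons, Option.mem_def, Option.some.injEq] at hx hy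
    rwa [← hx, ← hy]
  · cases p with
    | nil => simp at ha
    | cons => exact ha

theorem IsWalk.of_append {E : Fin m → Fin m → Prop} {F : Set (Fin m)} {p : List (Fin m)}
    {a g : Fin m} (h : IsWalk E F (p ++ [a, g])) : IsWalk E F (p ++ [a]) ∧ E a g := by
  obtain ⟨h1, b, hb, hbF⟩ := h
  rw [show p ++ [a, g] = (p ++ [a]) ++ [g] by simp, List.isChain_append] at h1
  refine ⟨⟨h1.1, b, ?_, hbF⟩, h1.2.2 a (by simp) g (by simp)⟩
  cases p with
  | nil => exact hb
  | cons => exact hb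

theorem eq_singleton_or_append {p : List (Fin m)} {g : Fin m} (h : p.getLast? = some g) :
    p = [g] ∨ ∃ p' a, p = p' ++ [a, g] := by
  obtain ⟨p₁, rfl⟩ := List.getLast?_eq_some_iff.1 h
  rcases List.eq_nil_or_concat p₁ with rfl | ⟨p', a, rfl⟩
  · exact Or.inl rfl
  · exact Or.inr ⟨p', a, by simp⟩

namespace SearchInv

variable {E : Fin m → Fin m → Prop} {F : Set (Fin m)} {o : Fin m → Option (Fin n)}
  {d k : ℕ} {q : Search m}

omit [NeZero n] in
/-- When a layer has been processed, all walks of the next length end in visited items. -/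
theorem far_succ (h : SearchInv E F o d k [] q) {p : List (Fin m)} (hp : IsWalk E F p)
    (hk : p.length ≤ k + 1) {g : Fin m} (hg : g ∈ p.getLast?) : g ∉ q.unvisited.items := by
  rcases eq_singleton_or_append hg with rfl | ⟨p', a, rfl⟩
  · obtain ⟨_, b, hb, hbF⟩ := hp
    simp only [List.head?_cons, Option.mem_def, Option.some.injEq] at hb
    subst hb
    exact h.first _ hbF
  -- The walk without its last item has length at most `k`, so its end `a` is visited and not in
  -- `next`. As nothing is left of the layer, the arrows from `a` lead to visited items only.
  · obtain ⟨h1, h2⟩ := hp.of_append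
    have h3 := h.far _ h1 (by simpa using hk) a (by simp)
    rcases h.closed a h3.1 with h4 | h4 | h4
    · simp at h4
    · exact absurd h4 h3.2
    · exact h4 g h2

omit [NeZero n] in
theorem advance (h : SearchInv E F o d k [] q) :
    SearchInv E F o d (k + 1) q.next { q with next := [] } where
  wf := h.wf
  first := h.first
  owned := h.owned
  layer := fun g hg => by
    obtain ⟨p, hp, hl⟩ := h.next g hg
    exact ⟨p, ⟨hp.traces, hp.walk, hp.last, hp.nodup, hp.visited⟩, hl⟩
  next := by simp
  closed := fun g hg => by
    rcases h.closed g hg with h1 | h1 | h1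
    · simp at h1
    · exact Or.inl h1
    · exact Or.inr (Or.inr h1)
  far := fun p hp hk g hg => ⟨h.far_succ hp hk hg, by simp⟩

omit [NeZero n] in
-- With both lists empty, the visited set contains `F` and is closed under arrows, so no walk leaves
-- it.
theorem none_of_empty (h : SearchInv E F o d k [] q) (hn : q.next = []) :
    ∀ p, IsWalk E F p → ∀ g ∈ p.getLast?, g ∉ q.unvisited.items := by
  intro p
  induction hp : p.length generalizing p with
  | zero => intro _ g hg; rw [List.length_eq_zero_iff] at hp; simp [hp] at hg
  | succ j ih =>
    intro hw g hg
    rcases eq_singleton_or_append hg with rfl | ⟨p', a, rfl⟩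
    · obtain ⟨_, b, hb, hbF⟩ := hw
      simp only [List.head?_cons, Option.mem_def, Option.some.injEq] at hb
      subst hb
      exact h.first _ hbF
    · obtain ⟨h1, h2⟩ := hw.of_append
      have h3 := ih (p' ++ [a]) (by simpa using hp) h1 a (by simp)
      rcases h.closed a h3 with h4 | h4 | h4
      · simp at h4
      · simp [hn] at h4
      · exact h4 g h2

end SearchInv

/-- The facts about the memory that the search relies on. -/
structure SearchReady (s : State n m) (E : Fin m → Fin m → Prop) (d : ℕ) : Prop where
  leaf : ∀ g y, s.owner g = some y → I.IsLeaf y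
  wf : ∀ y, (s.tree y).WF d 0
  rank_lt : ∀ g y, s.owner g = some y → I.u y ((s.tree y).items.erase g) + 1 = s.value y
  iff : ∀ g y, s.owner g = some y → ∀ h, h ≠ g →
    (s.value y ≤ I.u y (insert h ((s.tree y).items.erase g)) ↔ E g h)

/-- The time for an item of a layer, without the items that are visited from it. -/
def layerTime (d Tu : ℕ) : ℕ := visitTime d Tu + d + 6

/-- The fuel dominates a potential with weight two for unvisited items and for `next`, and weight
one for the current layer: a visit preserves it, while opening a layer and finishing an item of it
each lower it. In the time bound, visits are paid by the unvisited items, and the failing tests by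
the fuel. -/
theorem search_spec {s : State n m} {E : Fin m → Fin m → Prop} {F : Set (Fin m)} {d Tu : ℕ}
    (hs : I.SearchReady s E d) (hT : ∀ x S, I.IsLeaf x → I.evalTime x S ≤ Tu) (fuel : ℕ) (k : ℕ)
    (l : List (Fin m)) (q : Search m) (hq : SearchInv E F s.owner d k l q)
    (hfuel : 2 * q.unvisited.items.card + l.length + 2 * q.next.length < fuel) :
    (I.search s fuel l q).time ≤
      visitTime d Tu * q.unvisited.items.card + layerTime d Tu * fuel ∧
    IsSearchResult E F s.owner (I.search s fuel l q).val.1.pred (I.search s fuel l q).val.2 := by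
  induction fuel generalizing k l q with
  | zero => exact absurd hfuel (Nat.not_lt_zero _)
  | succ fuel ih =>
    have hK : 1 ≤ layerTime d Tu := by rw [layerTime]; omega
    cases l with
    | nil =>
      have hadv := hq.advance
      simp only [search, Timed.bind_val, Timed.bind_time, tick_time]
      cases hn : q.next with
      | nil =>
        simp only [Timed.pure_val, Timed.pure_time]
        refine ⟨by nlinarith, fun p hp g hg => hq.owned g (hq.none_of_empty hn p hp g hg)⟩
      | cons g l =>
        rw [hn] at hadv hfuel
        simp only
        obtain ⟨i1, i2⟩ := ih (k + 1) (g :: l) { q with next := [] } hadv (by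
          simp only [List.length_cons, List.length_nil] at hfuel ⊢
          omega)
        refine ⟨?_, i2⟩
        simp only at i1
        rw [Nat.mul_succ]
        omega
    | cons g l =>
      obtain ⟨p, hp, hpk⟩ := hq.layer g (by simp)
      have hgU : g ∉ q.unvisited.items := hp.visited g (List.mem_of_getLast? hp.last)
      obtain ⟨y, hy⟩ := Option.ne_none_iff_exists'.1 (hq.owned g hgU)
      have hleaf := hs.leaf g y hy
      obtain ⟨e1, e2, e3⟩ := (hs.wf y).erase g
      have hrank := hs.rank_lt g y hy
      have hcardU : q.unvisited.items.card < m + 1 := by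
        have := Finset.card_le_univ q.unvisited.items
        rw [Fintype.card_fin] at this
        omega
      -- The bundle of `y` without `g` has rank one less than the stored utility, so this utility is
      -- an admissible threshold.
      obtain ⟨x1, x2, x3⟩ := I.expand_spec s hleaf (A := ((s.tree y).erase g).val)
        (θ := s.value y) (by rw [e2]; linarith) (by rw [e2]; linarith) (some g)
        (fun S => hT y S hleaf) (m + 1) q hq.wf hcardU
      simp only [search, Timed.bind_val, Timed.bind_time, tick_time, rd_val, rd_time, hy, e3]
      rw [e2] at x3
      -- The item `g` itself would pass the test without being its own neighbour; it does no harm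
      -- because it is already visited.
      have hiff : ∀ h ∈ q.unvisited.items,
          (s.value y ≤ I.u y (insert h ((s.tree y).items.erase g)) ↔ E g h) := fun h hh =>
        hs.iff g y hy h fun e => hgU (e ▸ hh)
      generalize I.expand s y ((s.tree y).erase g).val (s.value y) (some g) (m + 1) q = R
        at x1 x2 x3
      obtain ⟨⟨q', r⟩, t⟩ := R
      simp only at x1 x2 x3 ⊢
      rcases x3 with ⟨g', hg', j1, j2, rfl, j4, j5⟩ | ⟨rfl, j2, j3, j4, j5, j6⟩
      · simp only [Timed.pure_val, Timed.pure_time]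
        have hL : layerTime d Tu = visitTime d Tu + d + 6 := rfl
        constructor
        · rw [Nat.mul_succ]
          nlinarith
        · refine ⟨p ++ [g'], Traces.step g' g p j4 (hp.traces.congr fun e he => ?_),
            hp.walk.append hp.last ((hiff g' hg').1 j1), by simp, ?_, j2, ?_⟩
          · exact j5 e (hp.visited e he)
          · rw [List.nodup_append]
            refine ⟨hp.nodup, by simp, ?_⟩
            intro a ha b hb
            rw [List.mem_singleton] at hb
            rintro rfl
            exact hp.visited a ha (hb ▸ hg')
          -- The path found has length `k + 1`. A shorter walk ends in a visited item, and all items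
          -- visited before are owned.
          · intro p' hp' ⟨h, hh, hnone⟩
            by_contra hlt
            simp only [List.length_append, List.length_cons, List.length_nil, not_le] at hlt
            exact hq.owned h (hq.far p' hp' (by omega) h hh).1 hnone
      · have hrec : ∀ {e p'}, Recorded E F q e p' → Recorded E F q' e p' := fun {e p'} he =>
          ⟨he.traces.congr fun a ha => j4 a (he.visited a ha), he.walk, he.last, he.nodup,
            fun a ha h => he.visited a ha ((j2 a).1 h).1⟩
        have hinv : SearchInv E F s.owner d k l q' := by
          refine ⟨x1, fun a ha h => hq.first a ha ((j2 a).1 h).1, fun a ha => ?_, fun a ha => ?_,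
            fun a ha => ?_, fun a ha => ?_, fun p' hp' hk a ha => ?_⟩
          · by_cases haU : a ∈ q.unvisited.items
            · refine (j3 a haU ?_).2
              by_contra hc
              exact ha ((j2 a).2 ⟨haU, hc⟩)
            · exact hq.owned a haU
          · obtain ⟨p', h1, h2⟩ := hq.layer a (by simp [ha])
            exact ⟨p', hrec h1, h2⟩
          · rcases (j5 a).1 ha with ha | ⟨ha, hok⟩
            · obtain ⟨p', h1, h2⟩ := hq.next a ha
              exact ⟨p', hrec h1, h2⟩
            · have hr := hrec hp
              refine ⟨p ++ [a], ⟨Traces.step a g p (j3 a ha hok).1 hr.traces,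
                hp.walk.append hp.last ((hiff a ha).1 hok), by simp, ?_, ?_⟩, by simp [hpk]⟩
              · rw [List.nodup_append]
                refine ⟨hp.nodup, by simp, ?_⟩
                intro c hc b hb
                rw [List.mem_singleton] at hb
                rintro rfl
                exact hp.visited c hc (hb ▸ ha)
              · intro e he h
                rcases List.mem_append.1 he with he | he
                · exact hr.visited e he h
                · rw [List.mem_singleton] at he
                  subst he
                  exact ((j2 e).1 h).2 hok
          · by_cases haU : a ∈ q.unvisited.items
            · refine Or.inr (Or.inl ((j5 a).2 (Or.inr ⟨haU, ?_⟩)))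
              by_contra hc
              exact ha ((j2 a).2 ⟨haU, hc⟩)
            · rcases hq.closed a haU with h | h | h
              -- The item just processed becomes closed: whatever is still unvisited has failed its
              -- test.
              · rcases List.mem_cons.1 h with rfl | h
                · refine Or.inr (Or.inr fun b hb hbU => ?_)
                  obtain ⟨hbU, hb'⟩ := (j2 b).1 hbU
                  exact hb' ((hiff b hbU).2 hb)
                · exact Or.inl h
              · exact Or.inr (Or.inl ((j5 a).2 (Or.inl h)))
              · exact Or.inr (Or.inr fun b hb hbU => h b hb ((j2 b).1 hbU).1)
          · obtain ⟨h1, h2⟩ := hq.far p' hp' hk a ha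
            refine ⟨fun h => h1 ((j2 a).1 h).1, fun h => ?_⟩
            rcases (j5 a).1 h with h | h
            · exact h2 h
            · exact h1 h.1
        have hle : q'.unvisited.items.card ≤ q.unvisited.items.card :=
          Finset.card_le_card fun a ha => ((j2 a).1 ha).1
        obtain ⟨i1, i2⟩ := ih k l q' hinv (by
          simp only [List.length_cons] at hfuel
          omega)
        refine ⟨?_, i2⟩
        have hL : layerTime d Tu = visitTime d Tu + d + 6 := rfl
        rw [Nat.mul_succ]
        nlinarith

/-- The first expansion adds items to the whole bundle of `x` with its utility plus one as
threshold, so the same test picks out the set `F` of possible first items. -/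
theorem findPath_spec {s : State n m} {E : Fin m → Fin m → Prop} {F : Set (Fin m)} {d Tu : ℕ}
    (hs : I.SearchReady s E d) (hT : ∀ x S, I.IsLeaf x → I.evalTime x S ≤ Tu)
    (hall : s.allItems.WF d 0) (hall' : s.allItems.items = Finset.univ) {x : Fin n}
    (hx : I.IsLeaf x) (hval : s.value x = I.u x (s.tree x).items)
    (hF : ∀ g, s.value x + 1 ≤ I.u x (insert g (s.tree x).items) ↔ g ∈ F) :
    (I.findPath s x).time ≤ visitTime d Tu * (m + 1) + layerTime d Tu * (2 * m + 2) + 3 * m + 3 ∧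
    ((∃ p, (I.findPath s x).val = some p ∧ p.Nodup ∧ IsWalk E F p ∧
        (∃ g ∈ p.getLast?, s.owner g = none) ∧
        ∀ p', IsWalk E F p' → (∃ g ∈ p'.getLast?, s.owner g = none) → p.length ≤ p'.length) ∨
      ((I.findPath s x).val = none ∧
        ∀ p, IsWalk E F p → ∀ g ∈ p.getLast?, s.owner g ≠ none)) := by
  have hlen : ∀ p : List (Fin m), p.Nodup → p.length ≤ m := fun p hp => by
    simpa using hp.length_le_card
  obtain ⟨x1, x2, x3⟩ := I.expand_spec s hx (A := s.tree x) (θ := s.value x + 1)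
    (by rw [hval]; linarith) (by rw [hval]) none (fun S => hT x S hx) (m + 1)
    ⟨s.allItems, fun _ => none, []⟩ hall (by simp [hall'])
  simp only [findPath, Timed.bind_val, Timed.bind_time, tick_time, rd_val, rd_time]
  simp only [hall', hF, Finset.card_univ, Fintype.card_fin, Finset.mem_univ, true_and,
    List.length_nil, List.not_mem_nil, false_or] at x1 x2 x3
  generalize I.expand s x (s.tree x) (s.value x + 1) none (m + 1)
    ⟨s.allItems, fun _ => none, []⟩ = R at x1 x2 x3
  obtain ⟨⟨q, r⟩, t⟩ := R
  simp only at x1 x2 x3 ⊢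
  rcases x3 with ⟨g, j1, j2, rfl, j4, -⟩ | ⟨rfl, j2, j3, -, j5, j6⟩
  · simp only [Timed.bind_val, Timed.bind_time, Timed.pure_val, Timed.pure_time]
    have hp := pathTo_time q.pred m g []
    refine ⟨by nlinarith, Or.inl ⟨[g], ?_, by simp, ⟨by simp, g, by simp, j1⟩,
      ⟨g, by simp, j2⟩, ?_⟩⟩
    · rw [(Traces.root g j4).pathTo_val (hlen [g] (by simp))]
      rfl
    · rintro p' ⟨_, g', hg', _⟩ -
      cases p' with
      | nil => simp at hg'
      | cons => simp
  -- The search starts with an empty layer `0`: the items of `F` are in `next`, with paths of length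
  -- one.
  · have hinv : SearchInv E F s.owner d 0 [] q := by
      refine ⟨x1, fun g hg h => (j2 g).1 h hg, fun g hg => ?_, by simp, fun g hg => ?_,
        fun g hg => ?_, fun p hp hk g hg => ?_⟩
      · rw [j2, not_not] at hg
        exact (j3 g trivial hg).2
      · have hgF := (j5 g).1 hg
        refine ⟨[g], ⟨Traces.root g (j3 g trivial hgF).1, ⟨by simp, g, by simp, hgF⟩,
          by simp, by simp, ?_⟩, rfl⟩
        intro e he
        rw [List.mem_singleton] at he
        subst he
        rw [j2, not_not]
        exact hgF
      · rw [j2, not_not] at hg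
        exact Or.inr (Or.inl ((j5 g).2 hg))
      · rw [Nat.le_zero, List.length_eq_zero_iff] at hk
        simp [hk] at hg
    obtain ⟨s1, s2⟩ := I.search_spec hs hT (2 * m + 2) 0 [] q hinv (by
      simp only [List.length_nil]
      omega)
    simp only [Timed.bind_val, Timed.bind_time]
    generalize I.search s (2 * m + 2) [] q = R at s1 s2
    obtain ⟨⟨q', r⟩, t'⟩ := R
    simp only at s1 s2 ⊢
    cases r with
    | none =>
      simp only [Timed.pure_val, Timed.pure_time]
      exact ⟨by nlinarith, Or.inr ⟨trivial, s2⟩⟩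
    | some g =>
      simp only [Timed.bind_val, Timed.bind_time, Timed.pure_val, Timed.pure_time]
      have hp := pathTo_time q'.pred m g []
      obtain ⟨p, y1, y2, y3, y4, y5, y6⟩ := s2
      refine ⟨by nlinarith, Or.inl ⟨p, ?_, y4, y2, ⟨g, y3, y5⟩, y6⟩⟩
      rw [y1.pathTo_val (hlen p y4)]
      simp

end Instance

namespace Instance

variable {n m : ℕ} [NeZero n] (I : Instance n m)

/-! ## Allocations given by the owners of the items -/

/-- The items that the leaf `y` owns. -/
def bundle (o : Fin m → Option (Fin n)) (y : Fin n) : Finset (Fin m) := {g | o g = some y}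

open Classical in
/-- The allocation in which `o g` is the leaf that owns the item `g`. -/
def allocOf (o : Fin m → Option (Fin n)) : Alloc n m := fun w => match w with
  | none => {g | o g = none}
  | some i => {g | i = 0 ∨ ∃ y, o g = some y ∧ I.Up y i}

variable {o : Fin m → Option (Fin n)}

omit [NeZero n] in
@[simp] theorem mem_bundle {y : Fin n} {g : Fin m} : g ∈ bundle o y ↔ o g = some y := by
  simp [bundle]

@[simp] theorem mem_allocOf_none {g : Fin m} : g ∈ I.allocOf o none ↔ o g = none := by
  simp [allocOf]

@[simp] theorem mem_allocOf_some {i : Fin n} {g : Fin m} :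
    g ∈ I.allocOf o (some i) ↔ i = 0 ∨ ∃ y, o g = some y ∧ I.Up y i := by
  simp [allocOf]

/-- No leaf lies strictly above another node. The root must be excluded as a leaf, since it holds
all items whoever owns them; this is harmless because the loop body runs only while the root has a
child. -/
theorem mem_allocOf_leaf (h0 : ¬ I.IsLeaf 0) {w : Option (Fin n)} (hw : I.IsExtLeaf w)
    {g : Fin m} : g ∈ I.allocOf o w ↔ o g = w := by
  cases w with
  | none => simp
  | some y =>
    have hy : I.IsLeaf y := hw
    rw [mem_allocOf_some]
    constructor
    · rintro (rfl | ⟨z, hz, h⟩)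
      · exact absurd hy h0
      · rw [hz, I.eq_of_up_leaf hy h]
    · exact fun h => Or.inr ⟨y, h, Up.refl I y⟩

theorem allocOf_leaf (h0 : ¬ I.IsLeaf 0) {y : Fin n} (hy : I.IsLeaf y) :
    I.allocOf o (some y) = bundle o y := by
  ext g
  rw [I.mem_allocOf_leaf h0 (w := some y) hy, mem_bundle]

/-- Among the leaves of the extended tree the owner of an item is unique, so the two leaves in the
definition of an arrow are determined. -/
theorem exchange_iff (h0 : ¬ I.IsLeaf 0) (hl : ∀ g y, o g = some y → I.IsLeaf y)
    {g h : Fin m} {y : Fin n} (hy : o g = some y) : I.Exchange (I.allocOf o) g h ↔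
      o h ≠ some y ∧ I.u y (insert h ((bundle o y).erase g)) = I.u y (bundle o y) := by
  have hset : ((bundle o y) \ {g}) ∪ {h} = insert h ((bundle o y).erase g) := by
    rw [Finset.sdiff_singleton_eq_erase, Finset.union_comm, ← Finset.insert_eq]
  have hleaf := hl g y hy
  constructor
  · rintro ⟨w, w', hw, hw', hne, hg, hh, hu⟩
    rw [I.mem_allocOf_leaf h0 hw, hy] at hg
    rw [I.mem_allocOf_leaf h0 hw'] at hh
    subst hg
    rw [I.allocOf_leaf h0 hw, hset] at hu
    exact ⟨fun e => hne (e.symm.trans hh), hu⟩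
  · rintro ⟨h1, h2⟩
    have hoh : I.IsExtLeaf (o h) := by
      cases e : o h with
      | none => trivial
      | some z => exact hl h z e
    refine ⟨some y, o h, hleaf, hoh, fun e => h1 e.symm,
      (I.mem_allocOf_leaf h0 (w := some y) hleaf).2 hy, (I.mem_allocOf_leaf h0 hoh).2 rfl, ?_⟩
    rw [I.allocOf_leaf h0 hleaf, hset]
    exact h2

theorem mem_gainItems_iff (h0 : ¬ I.IsLeaf 0) {x : Fin n} (hx : I.IsLeaf x) {g : Fin m} :
    g ∈ I.gainItems (I.allocOf o) x ↔
      I.u x (bundle o x) + 1 ≤ I.u x (insert g (bundle o x)) := by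
  rw [gainItems, Set.mem_ofPred_eq, I.allocOf_leaf h0 hx, Finset.union_comm, ← Finset.insert_eq]
  constructor
  · rintro ⟨_, h⟩
    linarith
  · intro h
    have h' := (I.rank_of_isLeaf hx).insert_cases (bundle o x) g
    refine ⟨fun hg => ?_, by rcases h' with h' | h' <;> linarith⟩
    rw [Finset.insert_eq_of_mem hg] at h
    linarith

/-- An item moves from its owner to another leaf. -/
theorem moveItem_allocOf (h0 : ¬ I.IsLeaf 0) (hl : ∀ g y, o g = some y → I.IsLeaf y) (g : Fin m)
    {x : Fin n} (hx : I.IsLeaf x) :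
    I.moveItem (I.allocOf o) g (o g) (some x) = I.allocOf (Function.update o g (some x)) := by
  have hx0 : x ≠ 0 := fun e => h0 (e ▸ hx)
  funext w
  ext h
  by_cases hh : h = g
  swap
  · have : h ∈ I.moveItem (I.allocOf o) g (o g) (some x) w ↔ h ∈ I.allocOf o w := by
      unfold moveItem
      split_ifs <;> simp [hh]
    rw [this]
    cases w <;> simp [Function.update_of_ne hh]
  subst hh
  cases w with
  | none =>
    have h1 : ¬ (none = some x ∨ ∃ i, none = some i ∧ I.IsAncestor i (some x) ∧
        ¬ I.IsAncestor i (o h)) := by simp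
    rw [moveItem, if_neg h1]
    split_ifs with h2
    · simp
    · have h3 : o h ≠ none := fun e => h2 (Or.inl e.symm)
      simp [h3]
  | some i =>
    -- After the move the item lies exactly in the bundles of `x` and of the nodes above it; the
    -- three branches of `moveItem` are checked against this.
    have hR : h ∈ I.allocOf (Function.update o h (some x)) (some i) ↔ I.Up x i := by
      simp only [mem_allocOf_some, Function.update_self, Option.some.injEq]
      constructor
      · rintro (rfl | ⟨y, rfl, h⟩)
        · exact I.up_root x
        · exact h
      · exact fun h => Or.inr ⟨x, rfl, h⟩
    rw [hR]
    unfold moveItem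
    split_ifs with h1 h2
    · simp only [Finset.mem_insert, true_or, true_iff]
      rcases h1 with h1 | ⟨j, hj, h1, _⟩
      · rw [Option.some.injEq] at h1
        exact h1 ▸ Up.refl I i
      · rw [Option.some.injEq] at hj
        exact hj ▸ (I.isAncestor_some_iff.1 h1).2
    · simp only [Finset.mem_erase, ne_eq, not_true_eq_false, false_and, false_iff]
      intro hu
      have hix : i ≠ x := fun e => h1 (Or.inl (e ▸ rfl))
      have hanc := I.isAncestor_some_iff.2 ⟨hix, hu⟩
      rcases h2 with h2 | ⟨j, hj, _, h2⟩
      · exact hix (I.eq_of_up_leaf (hl h i h2.symm) hu).symm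
      · rw [Option.some.injEq] at hj
        exact h2 (hj ▸ hanc)
    · constructor
      · intro hmem
        rw [mem_allocOf_some] at hmem
        rcases hmem with rfl | ⟨y, hy, hu⟩
        · exact I.up_root x
        · by_contra hxi
          refine h2 ?_
          by_cases hiy : i = y
          · exact Or.inl (by rw [hy, hiy])
          · refine Or.inr ⟨i, rfl, ?_, fun h => hxi (I.isAncestor_some_iff.1 h).2⟩
            rw [hy]
            exact I.isAncestor_some_iff.2 ⟨hiy, hu⟩
      · intro hu
        rw [mem_allocOf_some]
        have hix : i ≠ x := fun e => h1 (Or.inl (e ▸ rfl))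
        have hanc := I.isAncestor_some_iff.2 ⟨hix, hu⟩
        have h3 : I.IsAncestor i (o h) := by
          by_contra h3
          exact h1 (Or.inr ⟨i, rfl, hanc, h3⟩)
        cases ho : o h with
        | none =>
          rw [ho] at h3
          exact Or.inl h3
        | some y =>
          rw [ho] at h3
          exact Or.inr ⟨y, rfl, (I.isAncestor_some_iff.1 h3).2⟩

/-! ## The owners after a path augmentation -/

/-- The owners after the path augmentation in which the first item of the list goes to `z`. -/
def augOwner (o : Fin m → Option (Fin n)) : Option (Fin n) → List (Fin m) → Fin m → Option (Fin n)
  | _, [] => o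
  | z, g :: p => Function.update (augOwner o (o g) p) g z

omit [NeZero n] in
theorem augOwner_of_notMem {z : Option (Fin n)} {p : List (Fin m)} {g : Fin m} (hg : g ∉ p) :
    augOwner o z p g = o g := by
  induction p generalizing z with
  | nil => rfl
  | cons a p ih =>
    rw [List.mem_cons, not_or] at hg
    rw [augOwner, Function.update_of_ne hg.1, ih hg.2]

omit [NeZero n] in
theorem augOwner_mem {z : Option (Fin n)} (p : List (Fin m)) (g : Fin m) :
    augOwner o z p g = z ∨ ∃ h, augOwner o z p g = o h := by
  induction p generalizing z with
  | nil => exact Or.inr ⟨g, rfl⟩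
  | cons a p ih =>
    rw [augOwner]
    by_cases hg : g = a
    · subst hg
      exact Or.inl (Function.update_self ..)
    · rw [Function.update_of_ne hg]
      rcases ih (z := o a) with h | h
      · exact Or.inr ⟨a, h⟩
      · exact Or.inr h

theorem augments_allocOf (h0 : ¬ I.IsLeaf 0) (hl : ∀ g y, o g = some y → I.IsLeaf y)
    {p : List (Fin m)} (hp : p.Nodup) (hd : ∀ e ∈ p.dropLast, o e ≠ none) {z : Option (Fin n)}
    (hz : p = [] ∨ ∃ x, z = some x ∧ I.IsLeaf x) :
    I.Augments (I.allocOf o) z p (I.allocOf (augOwner o z p)) := by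
  induction p generalizing z with
  | nil => exact Augments.nil z
  | cons g p ih =>
    rw [List.nodup_cons] at hp
    obtain ⟨x, rfl, hx⟩ := hz.resolve_left (by simp)
    -- The path has no repetitions, so `g` still has its old owner after the rest of the path has
    -- been shifted.
    have hog : augOwner o (o g) p g = o g := augOwner_of_notMem hp.1
    have hext : I.IsExtLeaf (o g) := by
      cases e : o g with
      | none => trivial
      | some y => exact hl g y e
    have hl' : ∀ h y, augOwner o (o g) p h = some y → I.IsLeaf y := by
      intro h y hy
      rcases augOwner_mem (o := o) (z := o g) p h with e | ⟨h', e⟩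
      · exact hl g y (e ▸ hy)
      · exact hl h' y (e ▸ hy)
    have h1 := I.moveItem_allocOf h0 hl' g hx
    rw [hog] at h1
    rw [augOwner, ← h1]
    refine Augments.cons _ _ g p _ hext ((I.mem_allocOf_leaf h0 hext).2 rfl) (ih hp.2 ?_ ?_)
    · intro e he
      refine hd e ?_
      cases p with
      | nil => simp at he
      | cons => rw [List.dropLast_cons_cons]; exact List.mem_cons_of_mem _ he
    · cases p with
      | nil => exact Or.inl rfl
      | cons b p =>
        obtain ⟨y, hy⟩ := Option.ne_none_iff_exists'.1 (hd g (by simp))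
        exact Or.inr ⟨y, hy, hl g y hy⟩

omit [NeZero n] in
-- Each item takes over the owner of its predecessor on the path, which is a leaf because only the
-- last item may be unowned.
theorem augOwner_eq_none_iff {p : List (Fin m)} (hd : ∀ e ∈ p.dropLast, o e ≠ none) {x : Fin n}
    {a : Fin m} (ha : p.getLast? = some a) {e : Fin m} :
    augOwner o (some x) p e = none ↔ o e = none ∧ e ≠ a := by
  induction p generalizing x with
  | nil => simp at ha
  | cons g p ih =>
    rw [augOwner]
    cases p with
    | nil =>
      simp only [List.getLast?_singleton, Option.some.injEq] at ha
      subst ha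
      by_cases he : e = g
      · subst he; simp
      · simp [augOwner, he]
    | cons h p =>
      rw [List.dropLast_cons_cons] at hd
      rw [List.getLast?_cons_cons] at ha
      obtain ⟨y, hy⟩ := Option.ne_none_iff_exists'.1 (hd g (by simp))
      by_cases he : e = g
      · subst he
        simp [hy]
      · rw [Function.update_of_ne he, hy]
        exact ih (fun b hb => hd b (by simp [hb])) ha

/-- The bundle of `y` after the exchanges along the path, without the first item of the path. -/
def exchanged (o : Fin m → Option (Fin n)) (y : Fin n) : List (Fin m) → Finset (Fin m)
  | [] => bundle o y
  | [_] => bundle o y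
  | g :: h :: p =>
      if o g = some y then insert h ((exchanged o y (h :: p)).erase g) else exchanged o y (h :: p)

omit [NeZero n] in
-- An exchange at an arrow brings in the head of the arrow, so the first item of the list never
-- enters.
theorem mem_or_of_mem_exchanged {y : Fin n} {g : Fin m} {p : List (Fin m)} {e : Fin m}
    (he : e ∈ exchanged o y (g :: p)) : o e = some y ∨ e ∈ p := by
  induction p generalizing g with
  | nil => exact Or.inl (by simpa [exchanged] using he)
  | cons h p ih =>
    rw [exchanged] at he
    split_ifs at he
    · rcases Finset.mem_insert.1 he with rfl | he
      · exact Or.inr (by simp)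
      · exact (ih (Finset.mem_of_mem_erase he)).imp_right fun h => by simp [h]
    · exact (ih he).imp_right fun h => by simp [h]

omit [NeZero n] in
theorem mem_exchanged_of_notMem {y : Fin n} {p : List (Fin m)} {e : Fin m}
    (he : o e = some y) (hp : e ∉ p) : e ∈ exchanged o y p := by
  induction p with
  | nil => simpa [exchanged] using he
  | cons g p ih =>
    rw [List.mem_cons, not_or] at hp
    cases p with
    | nil => simpa [exchanged] using he
    | cons h p =>
      rw [exchanged]
      split_ifs
      · exact Finset.mem_insert_of_mem (Finset.mem_erase.2 ⟨hp.1, ih hp.2⟩)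
      · exact ih hp.2

omit [NeZero n] in
-- Seen from `y`, the shift of owners replaces each of its items on the path by the next item. The
-- first item of the path has no predecessor and is accounted for by `z`.
theorem bundle_augOwner {y : Fin n} {z : Option (Fin n)} {g : Fin m} {p : List (Fin m)}
    (hp : (g :: p).Nodup) {a : Fin m} (ha : (g :: p).getLast? = some a) (hoa : o a = none) :
    bundle (augOwner o z (g :: p)) y =
      if z = some y then insert g (exchanged o y (g :: p)) else exchanged o y (g :: p) := by
  induction p generalizing g z with
  | nil =>
    simp only [List.getLast?_singleton, Option.some.injEq] at ha
    subst ha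
    ext e
    simp only [augOwner, exchanged]
    by_cases he : e = g
    · subst he
      split_ifs with hz <;> simp [hz, hoa]
    · split_ifs with hz <;> simp [he]
  | cons h p ih =>
    rw [List.getLast?_cons_cons] at ha
    rw [List.nodup_cons] at hp
    have ih' := ih (z := o g) hp.2 ha
    have hgh : g ≠ h := fun e => hp.1 (by simp [e])
    have key : ∀ e, e ≠ g → (augOwner o (o g) (h :: p) e = some y ↔
        e ∈ exchanged o y (g :: h :: p)) := by
      intro e he
      rw [← mem_bundle, ih', exchanged]
      split_ifs
      · simp [he]
      · rfl
    have hg : g ∉ exchanged o y (g :: h :: p) := by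
      rw [exchanged]
      split_ifs with hy
      · simp [hgh]
      · intro hmem
        rcases mem_or_of_mem_exchanged hmem with h1 | h1
        · exact hy h1
        · exact hp.1 (by simp [h1])
    ext e
    rw [mem_bundle, augOwner]
    by_cases he : e = g
    · subst he
      rw [Function.update_self]
      split_ifs with hz <;> simp [hz, hg]
    · rw [Function.update_of_ne he, key e he]
      split_ifs <;> simp [he]

/-! ## Shortest transfer paths -/

section Shortest

variable {I} {π : Alloc n m} {x : Fin n} {p : List (Fin m)}

theorem IsTransferPath.splice {l r q : List (Fin m)} {g e : Fin m}
    (h : I.IsTransferPath π x (l ++ [g] ++ (r ++ e :: q))) (he : I.Exchange π g e) :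
    I.IsTransferPath π x (l ++ [g] ++ e :: q) := by
  obtain ⟨h1, ⟨a, ha, haF⟩, b, hb, hbn⟩ := h
  rw [List.isChain_append] at h1
  refine ⟨List.isChain_append.2 ⟨h1.1, (List.isChain_append.1 h1.2.1).2.1, ?_⟩, ⟨a, ?_, haF⟩,
    b, ?_, hbn⟩
  · intro c hc c' hc'
    simp only [List.getLast?_append, List.getLast?_singleton, Option.some_or, Option.mem_def,
      Option.some.injEq, List.head?_cons] at hc hc'
    rwa [← hc, ← hc']
  · cases l with
    | nil => exact ha
    | cons => exact ha
  · rw [← List.append_assoc, List.getLast?_append_cons] at hb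
    rw [List.getLast?_append_cons]
    exact hb

/-- Such an arrow would be a shortcut that skips at least the item `a`. -/
theorem IsShortestTransferPath.not_exchange (h : I.IsShortestTransferPath π x p)
    {l q : List (Fin m)} {g a e : Fin m} (hp : p = l ++ g :: a :: q) (he : e ∈ q) :
    ¬ I.Exchange π g e := by
  intro hE
  obtain ⟨r, q', rfl⟩ := List.append_of_mem he
  have h1 : p = l ++ [g] ++ ((a :: r) ++ e :: q') := by simp [hp]
  have h2 := h.2 _ ((h1 ▸ h.1).splice hE)
  rw [hp] at h2
  simp at h2
  omega

theorem IsShortestTransferPath.notMem_gainItems (h : I.IsShortestTransferPath π x p)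
    {q : List (Fin m)} {g e : Fin m} (hp : p = g :: q) (he : e ∈ q) : e ∉ I.gainItems π x := by
  intro hF
  obtain ⟨r, q', rfl⟩ := List.append_of_mem he
  obtain ⟨⟨h1, _, b, hb, hbn⟩, h2⟩ := h
  have h3 := h2 (e :: q') ⟨?_, ⟨e, by simp, hF⟩, b, ?_, hbn⟩
  · rw [hp] at h3
    simp at h3
    omega
  · rw [hp, show g :: (r ++ e :: q') = (g :: r) ++ e :: q' from rfl, List.isChain_append] at h1
    exact h1.2.1
  · rw [hp, show g :: (r ++ e :: q') = (g :: r) ++ e :: q' from rfl,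
      List.getLast?_append_cons] at hb
    exact hb

/-- Otherwise the path could be cut off at `e`. -/
theorem IsShortestTransferPath.notMem_none (h : I.IsShortestTransferPath π x p)
    {e : Fin m} (he : e ∈ p.dropLast) : e ∉ π none := by
  intro hn
  have hne : p ≠ [] := by rintro rfl; simp at he
  obtain ⟨r, q, hq⟩ := List.append_of_mem he
  have hp : p = (r ++ [e]) ++ (q ++ [p.getLast hne]) := by
    conv_lhs => rw [← List.dropLast_append_getLast hne, hq]
    simp
  generalize p.getLast hne = c at hp
  obtain ⟨⟨h1, ⟨b, hb, hbF⟩, _⟩, h2⟩ := h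
  have h3 := h2 (r ++ [e]) ⟨?_, ⟨b, ?_, hbF⟩, e, by simp, hn⟩
  · rw [hp] at h3
    simp at h3
  · rw [hp, List.isChain_append] at h1
    exact h1.1
  · rw [hp] at hb
    cases r with
    | nil => exact hb
    | cons => exact hb

end Shortest

/-- Along a shortest transfer path, the exchanges of a leaf preserve independence. -/
theorem exchanged_indep (h0 : ¬ I.IsLeaf 0) (hl : ∀ g y, o g = some y → I.IsLeaf y) {x : Fin n}
    {p : List (Fin m)} (hp : I.IsShortestTransferPath (I.allocOf o) x p) (hn : p.Nodup)
    {y : Fin n} (hy : I.IsLeaf y) (hi : I.u y (bundle o y) = (bundle o y).card)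
    {l q : List (Fin m)} (hq : p = l ++ q) :
    (exchanged o y q).card = (bundle o y).card ∧
      I.u y (exchanged o y q) = (bundle o y).card := by
  induction q generalizing l with
  | nil => exact ⟨rfl, hi⟩
  | cons g q ih =>
    cases q with
    | nil => exact ⟨rfl, hi⟩
    | cons h q =>
      obtain ⟨ih1, ih2⟩ := ih (l := l ++ [g]) (by simp [hq])
      rw [exchanged]
      split_ifs with hg
      swap
      · exact ⟨ih1, ih2⟩
      have hu := I.rank_of_isLeaf hy
      have hnq : (g :: h :: q).Nodup := by
        rw [hq] at hn
        exact (List.nodup_append.1 hn).2.1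
      rw [List.nodup_cons, List.nodup_cons] at hnq
      have hE : I.Exchange (I.allocOf o) g h := by
        have := hp.1.1
        rw [hq, List.isChain_append] at this
        exact (List.isChain_cons_cons.1 this.2.1).1
      rw [I.exchange_iff h0 hl hg] at hE
      have hgT : g ∈ exchanged o y (h :: q) := mem_exchanged_of_notMem hg hnq.1
      have hhT : h ∉ exchanged o y (h :: q) := fun hmem => by
        rcases mem_or_of_mem_exchanged hmem with h1 | h1
        · exact hE.1 h1
        · exact hnq.2.1 h1
      have hSg : I.u y ((bundle o y).erase g) = I.u y (bundle o y) - 1 :=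
        hu.erase_of_indep (I.u_empty_of_isLeaf hy) hi (by simpa using hg)
      have hTg : I.u y ((exchanged o y (h :: q)).erase g) = I.u y (exchanged o y (h :: q)) - 1 :=
        hu.erase_of_indep (I.u_empty_of_isLeaf hy) (by rw [ih2, ih1]) hgT
      constructor
      · rw [Finset.card_insert_of_notMem fun h' => hhT (Finset.mem_of_mem_erase h'),
          Finset.card_erase_of_mem hgT, ih1]
        have : 0 < (bundle o y).card := Finset.card_pos.2 ⟨g, by simpa using hg⟩
        omega
      -- The current bundle without `g` lies in the span of the original bundle without `g`, and the
      -- arrow from `g` to `h` puts `h` outside of that span; so `h` restores the unit of rank lost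
      -- with `g`.
      · rw [hu.insert_of_span (X := (exchanged o y (h :: q)).erase g)
          (Y := (bundle o y).erase g) ?_ (by rw [hE.2, hSg]; ring), hTg, ih2]
        · ring
        · intro e he
          rw [Finset.mem_erase] at he
          by_cases hoe : o e = some y
          · rw [Finset.insert_eq_of_mem]
            simpa using ⟨he.1, hoe⟩
          -- An item acquired by `y` lies beyond `h`; if it were outside of the span, there would be
          -- a shortcut from `g` to it.
          · have heq : e ∈ q := (mem_or_of_mem_exchanged he.2).resolve_left hoe
            have hnE := hp.not_exchange hq heq
            rw [I.exchange_iff h0 hl hg] at hnE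
            refine (hu.insert_cases _ e).resolve_right fun h1 => hnE ⟨hoe, ?_⟩
            rw [h1, hSg]
            ring

/-- Augmentation along a shortest transfer path. -/
theorem augOwner_indep (h0 : ¬ I.IsLeaf 0) (hl : ∀ g y, o g = some y → I.IsLeaf y) {x : Fin n}
    (hx : I.IsLeaf x) {p : List (Fin m)}
    (hp : I.IsShortestTransferPath (I.allocOf o) x p) (hn : p.Nodup)
    (hi : ∀ y, I.IsLeaf y → I.u y (bundle o y) = (bundle o y).card) {y : Fin n}
    (hy : I.IsLeaf y) :
    I.u y (bundle (augOwner o (some x) p) y) = I.u y (bundle o y) + (if y = x then 1 else 0) ∧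
      I.u y (bundle (augOwner o (some x) p) y) = (bundle (augOwner o (some x) p) y).card := by
  obtain ⟨a, ha, han⟩ := hp.1.2.2
  rw [mem_allocOf_none] at han
  obtain ⟨h1, h2⟩ := I.exchanged_indep h0 hl hp hn hy (hi y hy) (l := []) rfl
  cases p with
  | nil => simp at ha
  | cons g q =>
    rw [bundle_augOwner hn ha han]
    by_cases hxy : y = x
    · subst hxy
      rw [if_pos rfl, if_pos rfl]
      have hu := I.rank_of_isLeaf hy
      obtain ⟨b, hb, hbF⟩ := hp.1.2.1
      simp only [List.head?_cons, Option.mem_def, Option.some.injEq] at hb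
      subst hb
      rw [I.mem_gainItems_iff h0 hy] at hbF
      -- The items that `x` acquires by exchanges come after the first one, so on a shortest path
      -- they have no marginal gain over the old bundle, whereas `g` does.
      have hspan : ∀ e ∈ exchanged o y (g :: q),
          I.u y (insert e (bundle o y)) = I.u y (bundle o y) := by
        intro e he
        rcases mem_or_of_mem_exchanged he with h | h
        · rw [Finset.insert_eq_of_mem (by simpa using h)]
        · have := hp.notMem_gainItems rfl h
          rw [I.mem_gainItems_iff h0 hy] at this
          exact (hu.insert_cases _ e).resolve_right fun h' => this h'.ge
      have hgain : I.u y (insert g (bundle o y)) = I.u y (bundle o y) + 1 := by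
        rcases hu.insert_cases (bundle o y) g with h | h
        · linarith
        · exact h
      have h3 := hu.insert_of_span hspan hgain
      have hg : g ∉ exchanged o y (g :: q) := fun h => by
        rw [hspan g h] at hgain
        linarith
      rw [Finset.card_insert_of_notMem hg, h3, h2, h1, hi y hy]
      push_cast
      exact ⟨rfl, rfl⟩
    · rw [if_neg (fun e => hxy (Option.some.inj e).symm), if_neg hxy, h2, h1, hi y hy]
      simp

theorem card_unowned_augOwner {x : Fin n} {p : List (Fin m)}
    (hp : I.IsShortestTransferPath (I.allocOf o) x p) :
    (I.allocOf (augOwner o (some x) p) none).card + 1 = (I.allocOf o none).card := by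
  obtain ⟨a, ha, han⟩ := hp.1.2.2
  have : I.allocOf (augOwner o (some x) p) none = (I.allocOf o none).erase a := by
    ext e
    rw [mem_allocOf_none, augOwner_eq_none_iff (fun e he => ?_) ha, Finset.mem_erase,
      mem_allocOf_none, and_comm]
    simpa using hp.notMem_none he
  rw [this, Finset.card_erase_of_mem han]
  have := Finset.card_pos.2 ⟨a, han⟩
  omega

end Instance

namespace Instance

variable {n m : ℕ} [NeZero n] (I : Instance n m)

/-! ## Updates along the path to the root -/

open Classical in
theorem setBits_val (g : Fin m) (v : Bool) {fuel : ℕ} {i : Fin n} (hf : (i : ℕ) < fuel)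
    (a : Fin n × Fin m → Bool) (w : Fin n) (h : Fin m) :
    (I.setBits g v fuel i a).val (w, h) = if h = g ∧ w ≠ 0 ∧ I.Up i w then v else a (w, h) := by
  induction fuel generalizing i a with
  | zero => exact absurd hf (Nat.not_lt_zero _)
  | succ fuel ih =>
    simp only [setBits, Timed.bind_val]
    by_cases hi : i = 0
    · rw [if_pos hi, Timed.pure_val, if_neg]
      rintro ⟨_, h2, h3⟩
      rw [hi, up_zero_iff] at h3
      exact h2 h3
    · have hp := Fin.lt_def.1 (I.parent_lt i hi)
      simp only [if_neg hi, Timed.bind_val, wr_val, rd_val]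
      rw [ih (by omega), I.up_iff_parent hi]
      by_cases hw : w = i ∧ h = g
      · obtain ⟨rfl, rfl⟩ := hw
        simp [hi]
      · rw [Function.update_of_ne (by simpa using hw)]
        by_cases hh : h = g
        · have hwi : w ≠ i := fun e => hw ⟨e, hh⟩
          simp [hwi]
        · simp [hh]

theorem setBits_time (g : Fin m) (v : Bool) (fuel : ℕ) (i : Fin n) (a : Fin n × Fin m → Bool) :
    (I.setBits g v fuel i a).time ≤ 3 * fuel := by
  induction fuel generalizing i a with
  | zero => simp [setBits]
  | succ fuel ih =>
    simp only [setBits, Timed.bind_time, tick_time]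
    split_ifs with hi
    · simp only [Timed.pure_time]; omega
    · simp only [Timed.bind_time, wr_val, wr_time, rd_val, rd_time]
      have := ih (I.parent i) (Function.update a (i, g) v)
      omega

open Classical in
theorem increment_val {fuel : ℕ} {i : Fin n} (hf : (i : ℕ) < fuel) (a : Fin n → ℝ) (w : Fin n) :
    (I.increment fuel i a).val w = a w + if w ≠ 0 ∧ I.Up i w then 1 else 0 := by
  induction fuel generalizing i a with
  | zero => exact absurd hf (Nat.not_lt_zero _)
  | succ fuel ih =>
    simp only [increment, Timed.bind_val]
    by_cases hi : i = 0
    · rw [if_pos hi, Timed.pure_val, if_neg, add_zero]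
      rintro ⟨h2, h3⟩
      rw [hi, up_zero_iff] at h3
      exact h2 h3
    · have hlt := I.parent_lt i hi
      have hp := Fin.lt_def.1 hlt
      simp only [if_neg hi, Timed.bind_val, wr_val, rd_val]
      rw [ih (by omega), I.up_iff_parent hi]
      by_cases hw : w = i
      · subst hw
        have : ¬ I.Up (I.parent w) w := fun h => h.le.not_gt hlt
        simp [hi, this]
      · rw [Function.update_of_ne hw]
        simp [hw]

theorem increment_time (fuel : ℕ) (i : Fin n) (a : Fin n → ℝ) :
    (I.increment fuel i a).time ≤ 4 * fuel := by
  induction fuel generalizing i a with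
  | zero => simp [increment]
  | succ fuel ih =>
    simp only [increment, Timed.bind_time, tick_time]
    split_ifs with hi
    · simp only [Timed.pure_time]; omega
    · simp only [Timed.bind_time, wr_val, wr_time, rd_val, rd_time]
      have := ih (I.parent i) (Function.update a i (a i + 1))
      omega

/-! ## Reallocation of the items of a path -/

/-- The bundles in the memory are those given by the owners of the items. -/
structure ItemInv (s : State n m) (d : ℕ) : Prop where
  leaf : ∀ g y, s.owner g = some y → I.IsLeaf y
  bits : ∀ i g, s.bits (i, g) = true ↔ i = 0 ∨ ∃ y, s.owner g = some y ∧ I.Up y i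
  wf : ∀ y, (s.tree y).WF d 0
  items : ∀ y, (s.tree y).items = bundle s.owner y

/-- The array of owners still holds the old owner of `g` at this point, so `ItemInv` need not hold;
bits and trees are described as if `g` had no owner. -/
theorem detach_spec {s : State n m} {d : ℕ} (h : I.ItemInv s d) (g : Fin m) :
    (I.detach g (s.owner g) s).time ≤ 3 * n + d + 4 ∧
    ∃ bits tree, (I.detach g (s.owner g) s).val = { s with bits := bits, tree := tree } ∧
      (∀ i e, bits (i, e) = true ↔
        i = 0 ∨ e ≠ g ∧ ∃ y, s.owner e = some y ∧ I.Up y i) ∧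
      (∀ y, (tree y).WF d 0) ∧ ∀ y, (tree y).items = (bundle s.owner y).erase g := by
  cases ho : s.owner g with
  | none =>
    simp only [detach, Timed.bind_time, Timed.bind_val, tick_time, Timed.pure_val,
      Timed.pure_time]
    refine ⟨by omega, s.bits, s.tree, rfl, fun i e => ?_, h.wf, fun y => ?_⟩
    · rw [h.bits]
      by_cases he : e = g
      · simp [he, ho]
      · simp [he]
    · rw [h.items, Finset.erase_eq_of_notMem]
      simp [ho]
  | some z =>
    obtain ⟨e1, e2, e3⟩ := (h.wf z).erase g
    have hb := I.setBits_time g false n z s.bits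
    simp only [detach, Timed.bind_time, Timed.bind_val, tick_time, Timed.pure_val,
      Timed.pure_time, rd_val, rd_time, wr_val, wr_time, e3]
    refine ⟨by omega, _, _, rfl, fun i e => ?_, fun y => ?_, fun y => ?_⟩
    · rw [I.setBits_val g false z.isLt]
      by_cases he : e = g
      · subst he
        have := h.bits i e
        simp only [ho, Option.some.injEq, exists_eq_left'] at this
        split_ifs with hc
        · simp [hc.2.1]
        · rw [this]
          simp only [ne_eq, not_true_eq_false, false_and, or_false]
          refine ⟨fun h' => ?_, Or.inl⟩
          by_contra hi
          exact hc ⟨rfl, hi, h'.resolve_left hi⟩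
      · rw [if_neg fun h' => he h'.1, h.bits]
        simp [he]
    · by_cases hy : y = z
      · subst hy
        rw [Function.update_self]
        exact e1
      · rw [Function.update_of_ne hy]
        exact h.wf y
    · by_cases hy : y = z
      · subst hy
        rw [Function.update_self, e2, h.items]
      · rw [Function.update_of_ne hy, h.items, Finset.erase_eq_of_notMem]
        simpa [ho] using fun e => hy e.symm

theorem transfer_spec {s : State n m} {d : ℕ} (h : I.ItemInv s d) (hm : m ≤ 2 ^ d) (g : Fin m)
    {x : Fin n} (hx : I.IsLeaf x) :
    (I.attach g x (I.detach g (s.owner g) s).val).time ≤ 3 * n + d + 5 ∧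
    ∃ bits tree, (I.attach g x (I.detach g (s.owner g) s).val).val =
        { s with bits := bits, tree := tree, owner := Function.update s.owner g (some x) } ∧
      I.ItemInv { s with bits := bits, tree := tree, owner := Function.update s.owner g (some x) }
        d := by
  obtain ⟨-, bits, tree, h1, h2, h3, h4⟩ := I.detach_spec h g
  obtain ⟨e1, e2, e3⟩ := (h3 x).insert (Nat.zero_le g) (by have := g.isLt; omega)
  have hb := I.setBits_time g true n x bits
  simp only [attach, Timed.bind_time, Timed.bind_val, tick_time, Timed.pure_val,
    Timed.pure_time, rd_val, rd_time, wr_val, wr_time, h1, e3]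
  refine ⟨by omega, _, _, rfl, fun e y hy => ?_, fun i e => ?_, fun y => ?_, fun y => ?_⟩
  · simp only at hy
    by_cases he : e = g
    · subst he
      rw [Function.update_self, Option.some.injEq] at hy
      exact hy ▸ hx
    · rw [Function.update_of_ne he] at hy
      exact h.leaf e y hy
  · simp only
    rw [I.setBits_val g true x.isLt]
    by_cases he : e = g
    · subst he
      have := h2 i e
      simp only [ne_eq, not_true_eq_false, false_and, or_false] at this
      simp only [Function.update_self, Option.some.injEq, exists_eq_left', true_and]
      split_ifs with hc
      · simp [hc.2]
      · rw [this]
        refine ⟨Or.inl, fun h' => ?_⟩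
        by_contra hi
        exact hc ⟨rfl, hi, h'.resolve_left hi⟩
    · rw [if_neg fun h' => he h'.1, h2, Function.update_of_ne he]
      simp [he]
  · simp only
    by_cases hy : y = x
    · subst hy
      rw [Function.update_self]
      exact e1
    · rw [Function.update_of_ne hy]
      exact h3 y
  · simp only
    by_cases hy : y = x
    · subst hy
      rw [Function.update_self, e2, h4]
      ext e
      by_cases he : e = g
      · simp [he]
      · simp [he]
    · rw [Function.update_of_ne hy, h4]
      ext e
      by_cases he : e = g
      · subst he
        simpa using fun e' => hy e'.symm
      · simp [he]

omit [NeZero n] in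
-- The program treats the path from its first item, whereas `augOwner` recurses from the end;
-- without repetitions the two orders commute.
theorem augOwner_update {o : Fin m → Option (Fin n)} {p : List (Fin m)} {g : Fin m} (hg : g ∉ p)
    (w z : Option (Fin n)) :
    augOwner (Function.update o g w) z p = Function.update (augOwner o z p) g w := by
  induction p generalizing z with
  | nil => rfl
  | cons a p ih =>
    rw [List.mem_cons, not_or] at hg
    rw [augOwner, Function.update_of_ne (Ne.symm hg.1), ih hg.2, augOwner,
      Function.update_comm hg.1]

/-- The cost per item comes from two walks towards the root and two tree updates. -/
theorem reallocate_spec {s : State n m} {d : ℕ} (h : I.ItemInv s d) (hm : m ≤ 2 ^ d) {x : Fin n}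
    (hx : I.IsLeaf x) {p : List (Fin m)} (hp : p.Nodup)
    (hd : ∀ e ∈ p.dropLast, s.owner e ≠ none) :
    (I.reallocate x p s).time ≤ p.length * (6 * n + 2 * d + 11) + 1 ∧
    ∃ bits tree, (I.reallocate x p s).val =
        { s with bits := bits, tree := tree, owner := augOwner s.owner (some x) p } ∧
      I.ItemInv { s with bits := bits, tree := tree, owner := augOwner s.owner (some x) p } d := by
  induction p generalizing s x with
  | nil =>
    simp only [reallocate, Timed.bind_time, Timed.bind_val, tick_time, Timed.pure_val,
      Timed.pure_time]
    exact ⟨by simp, s.bits, s.tree, rfl, h⟩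
  | cons g p ih =>
    rw [List.nodup_cons] at hp
    obtain ⟨t1, -⟩ := I.detach_spec h g
    obtain ⟨t2, bits, tree, h1, h2⟩ := I.transfer_spec h hm g hx
    simp only [reallocate, Timed.bind_time, Timed.bind_val, tick_time, rd_val, rd_time,
      List.length_cons]
    rw [h1, Nat.succ_mul]
    cases ho : s.owner g with
    | none =>
      -- The program stops at an unowned item; by `hd` this is the last one.
      have hp' : p = [] := by
        by_contra hne
        obtain ⟨b, q, rfl⟩ := List.exists_cons_of_ne_nil hne
        exact hd g (by simp) ho
      subst hp'
      rw [ho] at t1 t2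
      simp only [Timed.pure_val, Timed.pure_time, List.length_nil]
      exact ⟨by omega, bits, tree, rfl, h2⟩
    | some y =>
      rw [ho] at t1 t2
      simp only
      obtain ⟨i1, bits', tree', i2, i3⟩ := ih h2 (h.leaf g y ho) hp.2 (fun e he => by
        have hep : e ∈ p := List.mem_of_mem_dropLast he
        have heg : e ≠ g := fun e' => hp.1 (e' ▸ hep)
        change Function.update s.owner g (some x) e ≠ none
        rw [Function.update_of_ne heg]
        refine hd e ?_
        cases p with
        | nil => simp at he
        | cons => rw [List.dropLast_cons_cons]; exact List.mem_cons_of_mem _ he)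
      refine ⟨by omega, bits', tree', ?_, ?_⟩
      · rw [i2, augOwner_update hp.1, augOwner, ho]
      · simp only [augOwner_update hp.1] at i3
        rw [augOwner, ho]
        exact i3

/-! ## Pruning -/

/-- The memory describes the current tree, in which every internal node other than the root and
possibly `e` has a child. -/
structure TreeInv (s : State n m) (e : Fin n) : Prop where
  sorted : ∀ i, (s.childList i).Pairwise (· < ·)
  mem : ∀ i j, j ∈ s.childList i ↔ j ∈ I.children i
  count : ∀ i, s.childCount i = (I.aliveChildren s.config.alive i).card
  root : 0 ∈ s.config.alive
  up : ∀ i, i ≠ 0 → i ∈ s.config.alive → I.parent i ∈ s.config.alive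
  inner : ∀ i, i ≠ 0 → i ≠ e → i ∈ s.config.alive → ¬ I.IsLeaf i →
    I.aliveChildren s.config.alive i ≠ ∅

omit [NeZero n] in
theorem mem_config_alive {s : State n m} {i : Fin n} :
    i ∈ s.config.alive ↔ s.alive i = true := by
  simp [State.config]

-- Only the parent of `i` loses a child, so the exceptional node moves from `i` to its parent.
variable {I} in
theorem TreeInv.remove {s : State n m} {i : Fin n} (h : I.TreeInv s i) (hi : i ≠ 0)
    (hia : i ∈ s.config.alive) (hc : I.aliveChildren s.config.alive i = ∅) :
    I.TreeInv { s with
      alive := Function.update s.alive i false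
      childCount := Function.update s.childCount (I.parent i) (s.childCount (I.parent i) - 1) }
      (I.parent i) ∧
    ({ s with
      alive := Function.update s.alive i false
      childCount := Function.update s.childCount (I.parent i)
        (s.childCount (I.parent i) - 1) } : State n m).config.alive = s.config.alive.erase i := by
  have hA : ({ s with
      alive := Function.update s.alive i false
      childCount := Function.update s.childCount (I.parent i)
        (s.childCount (I.parent i) - 1) } : State n m).config.alive = s.config.alive.erase i := by
    ext j
    rw [mem_config_alive, Finset.mem_erase, mem_config_alive]
    by_cases hj : j = i
    · simp [hj]
    · simp [hj]
  have hne : ∀ j, j ≠ I.parent i → I.aliveChildren (s.config.alive.erase i) j =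
      I.aliveChildren s.config.alive j := by
    intro j hj
    ext k
    simp only [aliveChildren, Finset.mem_inter, Finset.mem_erase]
    refine ⟨fun h => ⟨h.1, h.2.2⟩, fun h => ⟨h.1, fun e => hj ?_, h.2⟩⟩
    rw [← (I.mem_children.1 h.1).2, e]
  refine ⟨⟨h.sorted, h.mem, fun j => ?_, ?_, fun j hj hja => ?_, fun j hj hjp hja hl => ?_⟩, hA⟩
  · rw [hA]
    simp only
    by_cases hj : j = I.parent i
    · subst hj
      have : I.aliveChildren (s.config.alive.erase i) (I.parent i) =
          (I.aliveChildren s.config.alive (I.parent i)).erase i := by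
        rw [aliveChildren, aliveChildren, Finset.inter_erase]
      rw [Function.update_self, this, Finset.card_erase_of_mem, h.count]
      exact Finset.mem_inter.2 ⟨I.mem_children.2 ⟨hi, rfl⟩, hia⟩
    · rw [Function.update_of_ne hj, hne j hj, h.count]
  · rw [hA]
    exact Finset.mem_erase.2 ⟨hi.symm, h.root⟩
  · rw [hA, Finset.mem_erase] at hja ⊢
    refine ⟨fun e => ?_, h.up j hj hja.2⟩
    have : j ∈ I.aliveChildren s.config.alive i :=
      Finset.mem_inter.2 ⟨I.mem_children.2 ⟨hj, e⟩, hja.2⟩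
    rw [hc] at this
    simp at this
  · rw [hA] at hja ⊢
    rw [Finset.mem_erase] at hja
    rw [hne j hjp]
    exact h.inner j hj hja.1 hja.2 hl

/-- When the loop halts, the exceptional node is the root, which is exempt anyway, or still has a
child; in both cases the exception can be dropped. -/
theorem prune_spec (fuel : ℕ) {s : State n m} {i : Fin n} (h : I.TreeInv s i) (hi : i ≠ 0)
    (hia : i ∈ s.config.alive) (hc : I.aliveChildren s.config.alive i = ∅)
    (hf : (i : ℕ) < fuel) :
    (I.prune fuel i s).time ≤ 5 * fuel ∧
    ∃ alive count, (I.prune fuel i s).val = { s with alive := alive, childCount := count } ∧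
      I.TreeInv { s with alive := alive, childCount := count } 0 ∧
      I.Prunes i s.config.alive
        ({ s with alive := alive, childCount := count } : State n m).config.alive ∧
      ({ s with alive := alive, childCount := count } : State n m).config.alive ⊆
        s.config.alive.erase i := by
  induction fuel generalizing s i with
  | zero => exact absurd hf (Nat.not_lt_zero _)
  | succ fuel ih =>
    obtain ⟨h1, h2⟩ := h.remove hi hia hc
    have hlt := I.parent_lt i hi
    have hlt' := Fin.lt_def.1 hlt
    have hcount := h1.count (I.parent i)
    simp only [Function.update_self] at hcount
    simp only [prune, Timed.bind_time, Timed.bind_val, tick_time, rd_val, rd_time, wr_val, wr_time]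
    by_cases hhalt : I.parent i = 0 ∨ s.childCount (I.parent i) - 1 ≠ 0
    · simp only [if_pos hhalt, Timed.pure_val, Timed.pure_time]
      have hhalt' : I.parent i = 0 ∨
          I.aliveChildren (s.config.alive.erase i) (I.parent i) ≠ ∅ := by
        refine hhalt.imp_right fun h' => ?_
        rw [hcount, h2, Finset.card_ne_zero] at h'
        exact h'.ne_empty
      refine ⟨by omega, _, _, rfl, ⟨h1.sorted, h1.mem, h1.count, h1.root, h1.up, ?_⟩, ?_, ?_⟩
      · intro j hj _ hja hl
        by_cases hjp : j = I.parent i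
        · rw [h2, hjp]
          exact hhalt'.resolve_left (hjp ▸ hj)
        · exact h1.inner j hj hjp hja hl
      · rw [h2]
        exact Prunes.remove i _ _ hi hc (Prunes.halt _ _ hhalt')
      · rw [h2]
    · simp only [if_neg hhalt]
      rw [not_or, not_not, hcount, Finset.card_eq_zero] at hhalt
      have hpa : I.parent i ∈ s.config.alive.erase i :=
        Finset.mem_erase.2 ⟨hlt.ne, h.up i hi hia⟩
      obtain ⟨i1, alive, count, i2, i3, i4, i5⟩ := ih h1 hhalt.1 (h2 ▸ hpa) hhalt.2 (by omega)
      refine ⟨by omega, alive, count, i2, i3, Prunes.remove i _ _ hi hc (h2 ▸ i4), ?_⟩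
      refine i5.trans ?_
      rw [h2]
      exact Finset.erase_subset _ _

/-! ## Initialization -/

/-- Prepending reverses the order, so the decreasing input of `start` produces the increasing lists
that tie-breaking needs. -/
theorem buildChildren_val (is : List (Fin n)) (l : Fin n → List (Fin n)) (c : Fin n → ℕ) :
    (I.buildChildren is l c).val =
      (fun p => (is.reverse.filter fun j => j ≠ 0 ∧ I.parent j = p) ++ l p,
        fun p => c p + (is.filter fun j => j ≠ 0 ∧ I.parent j = p).length) := by
  induction is generalizing l c with
  | nil => simp [buildChildren]
  | cons i is ih =>
    simp only [buildChildren, Timed.bind_val]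
    by_cases hi : i = 0
    · rw [if_pos hi, ih]
      simp [hi]
    · simp only [if_neg hi, Timed.bind_val, rd_val, wr_val]
      rw [ih]
      ext p : 2
      · by_cases hp : p = I.parent i
        · subst hp
          simp [hi]
        · simp [Function.update_of_ne hp, Ne.symm hp]
      · by_cases hp : p = I.parent i
        · subst hp
          simp [hi]
          omega
        · simp [Function.update_of_ne hp, Ne.symm hp]

theorem buildChildren_time (is : List (Fin n)) (l : Fin n → List (Fin n)) (c : Fin n → ℕ) :
    (I.buildChildren is l c).time ≤ 6 * is.length + 1 := by
  induction is generalizing l c with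
  | nil => simp [buildChildren]
  | cons i is ih =>
    simp only [buildChildren, Timed.bind_time, tick_time, List.length_cons]
    by_cases hi : i = 0
    · rw [if_pos hi]
      have := ih l c
      omega
    · simp only [if_neg hi, Timed.bind_time, rd_val, wr_val, rd_time, wr_time]
      have := ih (Function.update l (I.parent i) (i :: l (I.parent i)))
        (Function.update c (I.parent i) (c (I.parent i) + 1))
      omega

theorem start_time : I.start.time ≤ 8 * 2 ^ Nat.clog 2 m + Nat.clog 2 m + n * m + m + 12 * n := by
  have h1 := I.buildChildren_time (List.finRange n).reverse (fun _ => []) (fun _ => 0)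
  have h2 := ItemTree.build_time (m := m) true (Nat.clog 2 m) 0
  have h3 := ItemTree.build_time (m := m) false (Nat.clog 2 m) 0
  have h4 : 1 ≤ 2 ^ Nat.clog 2 m := Nat.one_le_two_pow
  rw [List.length_reverse, List.length_finRange] at h1
  simp only [start, Timed.bind_time, tick_time, Timed.pure_time]
  omega

/-- The data structures are correct. -/
structure Inv (s : State n m) (d : ℕ) : Prop where
  item : I.ItemInv s d
  tree : I.TreeInv s 0
  all_wf : s.allItems.WF d 0
  all_items : s.allItems.items = Finset.univ
  value : ∀ i, i ≠ 0 → s.value i = I.utility (I.allocOf s.owner) i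
  indep : ∀ y, I.IsLeaf y → I.u y (bundle s.owner y) = (bundle s.owner y).card

variable {I} in
theorem ItemInv.config_eq {s : State n m} {d : ℕ} (h : I.ItemInv s d) :
    s.config = ⟨s.config.alive, I.allocOf s.owner⟩ := by
  have : s.config.alloc = I.allocOf s.owner := by
    funext w
    ext g
    cases w with
    | none => simp [State.config]
    | some i => simp [State.config, h.bits]
  rw [← this]

theorem utility_allocOf_none {i : Fin n} (hi : i ≠ 0) :
    I.utility (I.allocOf fun _ => none) i = 0 := by
  induction i using WellFoundedGT.induction with
  | _ i ih =>
    by_cases hl : I.IsLeaf i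
    · rw [I.utility_leaf _ hl]
      have : I.allocOf (fun _ => none) (some i) = (∅ : Finset (Fin m)) := by
        ext g
        simp [hi]
      rw [this, I.u_empty_of_isLeaf hl]
    · rw [I.utility_internal _ hl]
      exact Finset.sum_eq_zero fun j hj =>
        ih j (I.lt_of_mem_children hj) (I.mem_children.1 hj).1

theorem start_inv : I.Inv I.start.val (Nat.clog 2 m) := by
  have hm : m ≤ 2 ^ Nat.clog 2 m := Nat.le_pow_clog (by norm_num) m
  have hbundle : ∀ y : Fin n, bundle (fun _ : Fin m => none) y = ∅ := fun y => by
    ext; simp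
  have hmem : ∀ i j, j ∈ I.start.val.childList i ↔ j ∈ I.children i := by
    intro i j
    simp only [start, Timed.bind_val, Timed.pure_val, buildChildren_val]
    simp [mem_children]
  have hsorted : ∀ i, (I.start.val.childList i).Pairwise (· < ·) := by
    intro i
    simp only [start, Timed.bind_val, Timed.pure_val, buildChildren_val, List.reverse_reverse,
      List.append_nil]
    exact (List.pairwise_lt_finRange n).filter _
  have halive : I.start.val.config.alive = Finset.univ := by
    ext i
    simp [mem_config_alive, start]
  refine ⟨⟨?_, ?_, ?_, ?_⟩, ⟨hsorted, hmem, ?_, ?_, ?_, ?_⟩, ?_, ?_, ?_, ?_⟩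
  · simp [start]
  · simp [start]
  · exact fun y => ItemTree.build_wf ..
  · intro y
    simp only [start, Timed.bind_val, Timed.pure_val, ItemTree.build_false_items, hbundle]
  · intro i
    rw [halive, aliveChildren, Finset.inter_univ]
    have hlen : I.start.val.childCount i = (I.start.val.childList i).length := by
      simp only [start, Timed.bind_val, Timed.pure_val, buildChildren_val, List.reverse_reverse,
        List.append_nil, zero_add]
      rw [List.filter_reverse, List.length_reverse]
    rw [hlen, ← List.toFinset_card_of_nodup ((hsorted i).imp fun h => h.ne)]
    congr 1
    ext j
    simp [hmem]
  · simp [halive]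
  · simp [halive]
  · intro i _ _ _ hl
    rw [halive, aliveChildren, Finset.inter_univ]
    exact hl
  · exact ItemTree.build_wf ..
  · ext g
    simp only [start, Timed.bind_val, Timed.pure_val, Finset.mem_univ, iff_true]
    exact ItemTree.mem_build_true_items (Nat.zero_le _) (by have := g.isLt; omega)
  · intro i hi
    simp only [start, Timed.bind_val, Timed.pure_val]
    exact (I.utility_allocOf_none hi).symm
  · intro y hy
    simp only [start, Timed.bind_val, Timed.pure_val, hbundle, I.u_empty_of_isLeaf hy,
      Finset.card_empty, Nat.cast_zero]

theorem start_config : I.start.val.config = initialConfig := by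
  have halive : I.start.val.config.alive = Finset.univ := by
    ext i
    simp [mem_config_alive, start]
  rw [I.start_inv.item.config_eq, halive, initialConfig]
  congr 1
  funext w
  ext g
  have ho : I.start.val.owner = fun _ => none := by
    simp only [start, Timed.bind_val, Timed.pure_val]
  rw [ho]
  cases w with
  | none => simp
  | some i => by_cases hi : i = 0 <;> simp [hi]

end Instance

namespace Instance

variable {n m : ℕ} [NeZero n] (I : Instance n m)

/-! ## One iteration -/

-- Independence makes every removal cost exactly one unit of rank, so the stored utility is the
-- right threshold. Another item of `y` itself adds nothing, in accordance with the absence of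
-- arrows inside a bundle.
variable {I} in
theorem Inv.searchReady {s : State n m} {d : ℕ} (h : I.Inv s d) (h0 : ¬ I.IsLeaf 0) :
    I.SearchReady s (I.Exchange (I.allocOf s.owner)) d where
  leaf := h.item.leaf
  wf := h.item.wf
  rank_lt := fun g y hy => by
    have hl := h.item.leaf g y hy
    have hy0 : y ≠ 0 := fun e => h0 (e ▸ hl)
    rw [h.value y hy0, I.utility_leaf _ hl, I.allocOf_leaf h0 hl, h.item.items,
      (I.rank_of_isLeaf hl).erase_of_indep (I.u_empty_of_isLeaf hl) (h.indep y hl) (by simpa)]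
    ring
  iff := fun g y hy e he => by
    have hl := h.item.leaf g y hy
    have hy0 : y ≠ 0 := fun e => h0 (e ▸ hl)
    have hu := I.rank_of_isLeaf hl
    have herase := hu.erase_of_indep (I.u_empty_of_isLeaf hl) (h.indep y hl) (g := g) (by simpa)
    rw [h.value y hy0, I.utility_leaf _ hl, I.allocOf_leaf h0 hl, h.item.items,
      I.exchange_iff h0 h.item.leaf hy]
    constructor
    · intro hle
      refine ⟨fun hoe => ?_, ?_⟩
      · rw [Finset.insert_eq_of_mem (by simp [he, hoe]), herase] at hle
        linarith
      · rcases hu.insert_cases ((bundle s.owner y).erase g) e with h1 | h1 <;> linarith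
    · exact fun h' => h'.2.ge

/-- A constant multiple of this number bounds the time of one iteration. -/
def workload (n m Tu b d : ℕ) : ℕ := m * Tu * (d + 1) + m * n + n * b

variable {I} in
theorem Inv.iterate {s : State n m} {d Tu b : ℕ} (h : I.Inv s d) (hm : m ≤ 2 ^ d)
    (hm1 : 1 ≤ m) (hT1 : 1 ≤ Tu) (hb : 1 ≤ b) (hT : ∀ x S, I.IsLeaf x → I.evalTime x S ≤ Tu)
    (hd : ∀ i, ¬ I.IsLeaf i → I.gainDim i ≤ b) (hc : s.childCount 0 ≠ 0) :
    (I.iterate s).time ≤ 200 * workload n m Tu b d ∧ I.Inv (I.iterate s).val d ∧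
      I.Step s.config (I.iterate s).val.config ∧
      (I.allocOf (I.iterate s).val.owner none).card + (I.iterate s).val.config.alive.card + 1 ≤
        (I.allocOf s.owner none).card + s.config.alive.card := by
  have hn1 : 1 ≤ n := Nat.one_le_iff_ne_zero.2 (NeZero.ne n)
  have hcount : ∀ i, s.childCount i ≠ 0 → (I.aliveChildren s.config.alive i).Nonempty := by
    intro i hi
    rwa [h.tree.count, Finset.card_ne_zero] at hi
  have hleaf : ∀ i, s.childCount i ≠ 0 → ¬ I.IsLeaf i := by
    intro i hi hl
    obtain ⟨j, hj⟩ := hcount i hi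
    have hj' := (Finset.mem_inter.1 hj).1
    rw [show I.children i = ∅ from hl] at hj'
    simp at hj'
  have h0 := hleaf 0 hc
  have hA : s.config.alive ≠ {0} := by
    intro hA
    obtain ⟨j, hj⟩ := hcount 0 hc
    rw [aliveChildren, hA, Finset.mem_inter, mem_children, Finset.mem_singleton] at hj
    exact hj.1.1 hj.2
  obtain ⟨x1, x2, x3, -⟩ := I.selectLeaf_spec (π := I.allocOf s.owner)
    (fun i => mem_config_alive.symm) h.tree.sorted h.tree.mem h.tree.count h.value n
    (i := 0) h.tree.root (by simp)
  have xt := I.selectLeaf_time hb h.tree.sorted h.tree.mem hleaf hd n 0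
  have hbelow : (I.below 0).card ≤ n := by
    simpa using Finset.card_le_univ (I.below 0)
  have hbelow' := Nat.mul_le_mul_right (13 * b) hbelow
  simp only [Instance.iterate, Timed.bind_time, Timed.bind_val, tick_time]
  generalize (I.selectLeaf s n 0).val = x at x1 x2 x3
  -- The selected node has no child left, but the root does.
  have hx0 : x ≠ 0 := by
    rintro rfl
    obtain ⟨j, hj⟩ := hcount 0 hc
    rw [x3] at hj
    simp at hj
  -- By the tree invariant, an internal node other than the root that is still in the tree has a
  -- child there.
  have hx : I.IsLeaf x := by
    by_contra hl
    exact h.tree.inner x hx0 hx0 x2 hl x3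
  have hval : s.value x = I.u x (s.tree x).items := by
    rw [h.value x hx0, I.utility_leaf _ hx, I.allocOf_leaf h0 hx, h.item.items]
  obtain ⟨ft, fp⟩ := I.findPath_spec (h.searchReady h0) hT h.all_wf h.all_items hx hval
    (F := I.gainItems (I.allocOf s.owner) x) (fun g => by
      rw [I.mem_gainItems_iff h0 hx, hval, h.item.items])
  have hft : (I.findPath s x).time ≤ 100 * (m * Tu * (d + 1)) := by
    have hK : visitTime d Tu ≤ 9 * (Tu * (d + 1)) := by rw [visitTime]; nlinarith
    have hL : layerTime d Tu ≤ 16 * (Tu * (d + 1)) := by rw [layerTime]; nlinarith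
    have hX : 1 ≤ Tu * (d + 1) := Nat.mul_pos hT1 (Nat.succ_pos d)
    rw [mul_assoc]
    generalize Tu * (d + 1) = X at hK hL hX ⊢
    have h1 : visitTime d Tu * (m + 1) ≤ 9 * X * (m + 1) := Nat.mul_le_mul_right _ hK
    have h2 : layerTime d Tu * (2 * m + 2) ≤ 16 * X * (2 * m + 2) := Nat.mul_le_mul_right _ hL
    have h3 : X ≤ m * X := Nat.le_mul_of_pos_left X hm1
    have h4 : m ≤ m * X := Nat.le_mul_of_pos_right m hX
    nlinarith
  rw [h.item.config_eq]
  rcases fp with ⟨p, hp, hnodup, hwalk, hlast, hmin⟩ | ⟨hp, hno⟩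
  · rw [hp]
    have hsp : I.IsShortestTransferPath (I.allocOf s.owner) x p := by
      refine ⟨⟨hwalk.1, hwalk.2, by simpa using hlast⟩, fun q hq => hmin q ⟨hq.1, hq.2.1⟩ ?_⟩
      simpa using hq.2.2
    have hown : ∀ e ∈ p.dropLast, s.owner e ≠ none := fun e he => by
      simpa using hsp.notMem_none he
    obtain ⟨rt, bits, tree, r1, r2⟩ := I.reallocate_spec h.item hm hx hnodup hown
    have it := I.increment_time n x s.value
    have hind := fun {y} (hy : I.IsLeaf y) =>
      I.augOwner_indep h0 h.item.leaf hx hsp hnodup h.indep hy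
    simp only [Timed.bind_time, Timed.bind_val, Timed.pure_val, Timed.pure_time]
    rw [r1]
    have hinv : I.Inv { s with
        owner := augOwner s.owner (some x) p
        bits := bits
        tree := tree
        value := (I.increment n x s.value).val } d := by
      refine ⟨⟨r2.leaf, r2.bits, r2.wf, r2.items⟩, ⟨h.tree.sorted, h.tree.mem, h.tree.count,
        h.tree.root, h.tree.up, h.tree.inner⟩, h.all_wf, h.all_items, fun i hi => ?_,
        fun y hy => (hind hy).2⟩
      simp only
      -- The rank of the bundle grows by one for `x` and is unchanged for all other leaves, so the
      -- increments along the ancestors of `x` match the true utilities.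
      rw [I.increment_val x.isLt, h.value i hi, I.utility_add_one (π := I.allocOf s.owner)
        (π' := I.allocOf (augOwner s.owner (some x) p)) hx]
      · by_cases hu : I.Up x i
        · rw [if_pos hu, if_pos ⟨hi, hu⟩]
        · rw [if_neg hu, if_neg fun h' => hu h'.2]
      · rw [I.allocOf_leaf h0 hx, I.allocOf_leaf h0 hx, (hind hx).1, if_pos rfl]
      · intro y hy hyx
        rw [I.allocOf_leaf h0 hy, I.allocOf_leaf h0 hy, (hind hy).1, if_neg hyx, add_zero]
    refine ⟨?_, hinv, ?_, ?_⟩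
    · have hlen : p.length ≤ m := by simpa using hnodup.length_le_card
      have hlen' := Nat.mul_le_mul_right (6 * n + 2 * d + 11) hlen
      have hdm : m * (d + 1) ≤ m * Tu * (d + 1) :=
        Nat.mul_le_mul_right _ (Nat.le_mul_of_pos_right m hT1)
      have hnm : n ≤ m * n := Nat.le_mul_of_pos_left n hm1
      rw [workload]
      nlinarith
    · rw [hinv.item.config_eq]
      refine Step.augment _ _ _ x p hA x1 hsp ?_
      exact I.augments_allocOf h0 h.item.leaf hnodup hown (Or.inr ⟨x, rfl, hx⟩)
    · have := I.card_unowned_augOwner hsp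
      have hal : ({ s with
        owner := augOwner s.owner (some x) p
        bits := bits
        tree := tree
        value := (I.increment n x s.value).val } : State n m).config.alive = s.config.alive := rfl
      rw [hal]
      dsimp only
      omega
  · rw [hp]
    -- With the root as exceptional node the invariant makes no exception, so `x` may be named
    -- instead.
    obtain ⟨pt, alive, count, p1, p2, p3, p4⟩ := I.prune_spec n (s := s) (i := x)
      ⟨h.tree.sorted, h.tree.mem, h.tree.count, h.tree.root, h.tree.up,
        fun i hi _ => h.tree.inner i hi hi⟩ hx0 x2 x3 x.isLt
    simp only
    rw [p1]
    have hinv : I.Inv { s with alive := alive, childCount := count } d :=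
      ⟨⟨h.item.leaf, h.item.bits, h.item.wf, h.item.items⟩, p2, h.all_wf, h.all_items, h.value,
        h.indep⟩
    refine ⟨?_, hinv, ?_, ?_⟩
    · have hnm : n ≤ m * n := Nat.le_mul_of_pos_left n hm1
      rw [workload]
      nlinarith
    · rw [hinv.item.config_eq]
      refine Step.remove _ _ _ x hA x1 ?_ p3
      rintro ⟨q, hq⟩
      obtain ⟨g, hg, hgn⟩ := hq.2.2
      exact hno q ⟨hq.1, hq.2.1⟩ g hg (by simpa using hgn)
    · have h1 := Finset.card_le_card p4
      rw [Finset.card_erase_of_mem x2] at h1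
      have h2 := Finset.card_pos.2 ⟨x, x2⟩
      dsimp only
      omega

-- The tree is closed under parents, so any further node would lead up to a remaining child of the
-- root.
variable {I} in
theorem Inv.alive_eq {s : State n m} {d : ℕ} (h : I.Inv s d) (hc : s.childCount 0 = 0) :
    s.config.alive = {0} := by
  rw [h.tree.count, Finset.card_eq_zero] at hc
  refine Finset.eq_singleton_iff_unique_mem.2 ⟨h.tree.root, fun i => ?_⟩
  induction i using WellFoundedLT.induction with
  | _ i ih =>
    intro hi
    by_contra hi0
    have hp := ih _ (I.parent_lt i hi0) (h.tree.up i hi0 hi)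
    have : i ∈ I.aliveChildren s.config.alive 0 :=
      Finset.mem_inter.2 ⟨I.mem_children.2 ⟨hi0, hp⟩, hi⟩
    rw [hc] at this
    simp at this

/-! ## The whole run -/

theorem finished_val_iff (s : State n m) : (finished s).val = true ↔ s.childCount 0 = 0 := by
  simp [finished]

theorem finished_time (s : State n m) : (finished s).time = 2 := rfl

theorem exec_succ (k : ℕ) :
    (I.exec (k + 1)).val =
      (if (finished (I.exec k).val).val = true then (I.exec k).val
        else (I.iterate (I.exec k).val).val) ∧
    (I.exec (k + 1)).time = (I.exec k).time + 2 +
      if (finished (I.exec k).val).val = true then 0 else (I.iterate (I.exec k).val).time := by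
  simp only [exec, Timed.bind_val, Timed.bind_time, finished_time]
  split_ifs <;> simp [add_assoc]

/-- The last clause is the potential argument: as long as no test has succeeded, every iteration
lowers unowned items plus nodes by at least one. -/
theorem exec_spec {Tu b : ℕ} (hm : 1 ≤ m) (hT1 : 1 ≤ Tu) (hb : 1 ≤ b)
    (hT : ∀ x S, I.IsLeaf x → I.evalTime x S ≤ Tu)
    (hd : ∀ i, ¬ I.IsLeaf i → I.gainDim i ≤ b) (k : ℕ) :
    I.Inv (I.exec k).val (Nat.clog 2 m) ∧
    (I.exec k).time ≤ I.start.time + k * (200 * workload n m Tu b (Nat.clog 2 m) + 2) ∧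
    ((∀ l < k, (finished (I.exec l).val).val ≠ true) →
      (I.allocOf (I.exec k).val.owner none).card + (I.exec k).val.config.alive.card + k ≤
        m + n) := by
  induction k with
  | zero =>
    refine ⟨I.start_inv, by simp [exec], fun _ => ?_⟩
    have h1 := Finset.card_le_univ (I.allocOf (I.exec 0).val.owner none)
    have h2 := Finset.card_le_univ (I.exec 0).val.config.alive
    rw [Fintype.card_fin] at h1 h2
    omega
  | succ k ih =>
    obtain ⟨h1, h2, h3⟩ := ih
    obtain ⟨e1, e2⟩ := I.exec_succ k
    rw [e1, e2, Nat.succ_mul]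
    by_cases hf : (finished (I.exec k).val).val = true
    · rw [if_pos hf, if_pos hf]
      exact ⟨h1, by omega, fun h => absurd hf (h k (Nat.lt_succ_self k))⟩
    · rw [if_neg hf, if_neg hf]
      rw [finished_val_iff] at hf
      obtain ⟨i1, i2, -, i4⟩ := h1.iterate (Nat.le_pow_clog (by norm_num) m) hm hT1 hb hT hd hf
      refine ⟨i2, by omega, fun h => ?_⟩
      have := h3 fun l hl => h l (hl.trans (Nat.lt_succ_self k))
      omega

theorem exists_finished {Tu b : ℕ} (hm : 1 ≤ m) (hT1 : 1 ≤ Tu) (hb : 1 ≤ b)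
    (hT : ∀ x S, I.IsLeaf x → I.evalTime x S ≤ Tu)
    (hd : ∀ i, ¬ I.IsLeaf i → I.gainDim i ≤ b) :
    ∃ k ≤ m + n, (finished (I.exec k).val).val = true ∧
      ∀ l < k, (finished (I.exec l).val).val ≠ true := by
  have hex : ∃ k, (finished (I.exec k).val).val = true := by
    by_contra! hno
    have := (I.exec_spec hm hT1 hb hT hd (m + n + 1)).2.2 fun l _ => by simp [hno l]
    omega
  classical
  refine ⟨Nat.find hex, ?_, Nat.find_spec hex, fun l hl => Nat.find_min hex hl⟩
  have := (I.exec_spec hm hT1 hb hT hd (Nat.find hex)).2.2 fun l hl => Nat.find_min hex hl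
  omega

end Instance

/-! ### Comparison with the natural logarithm and the final bound -/

/-- For `m ≥ 2` the left side is at most `log₂ m + 2 ≤ 3 log₂ m`, and `log 2 > 1 / 2` turns the
factor 3 into 6. -/
theorem clog_add_one_le {m : ℕ} (hm : 2 ≤ m) : (Nat.clog 2 m + 1 : ℝ) ≤ 6 * Real.log m := by
  have h2 : (1 / 2 : ℝ) < Real.log 2 := by linarith [Real.log_two_gt_d9]
  have hm' : (2 : ℝ) ≤ m := by exact_mod_cast hm
  have h1 : Real.log 2 ≤ Real.log m := Real.log_le_log (by norm_num) hm'
  have h3 : ((Nat.clog 2 m : ℝ) - 1) * Real.log 2 ≤ Real.log m := by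
    have h4 : 2 ^ (Nat.clog 2 m).pred < m := Nat.pow_pred_clog_lt_self (by norm_num) (by omega)
    have h5 : ((2 : ℝ) ^ (Nat.clog 2 m).pred) ≤ m := by exact_mod_cast h4.le
    have h6 := Real.log_le_log (by positivity) h5
    rw [Real.log_pow] at h6
    have h7 : (Nat.clog 2 m : ℝ) - 1 ≤ ((Nat.clog 2 m).pred : ℝ) := by
      have : Nat.clog 2 m ≤ (Nat.clog 2 m).pred + 1 := by
        rw [Nat.pred_eq_sub_one]; omega
      have : (Nat.clog 2 m : ℝ) ≤ ((Nat.clog 2 m).pred : ℝ) + 1 := by exact_mod_cast this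
      linarith
    nlinarith
  nlinarith

end MGYS

end

theorem mainTheorem5 :
    ∃ C : ℝ, ∀ (n m : ℕ) [NeZero n] (I : MGYS.Instance n m) (Tu b : ℕ),
      2 ≤ m → 1 ≤ Tu → 1 ≤ b →
      (∀ x S, I.IsLeaf x → I.evalTime x S ≤ Tu) →
      (∀ i, ¬ I.IsLeaf i → I.gainDim i ≤ b) →
      ∃ k : ℕ,
        -- the program executes MGYS, iteration by iteration, and halts after `k` iterations
        (I.exec 0).val.config = MGYS.Instance.initialConfig ∧
        (∀ l < k, I.Step (I.exec l).val.config (I.exec (l + 1)).val.config) ∧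
        (I.exec k).val.config.alive = {0} ∧
        (MGYS.Instance.finished (I.exec k).val).val = true ∧
        -- its running time, including the last test of the outer loop
        ((I.exec (k + 1)).time : ℝ) ≤
          C * (((n : ℝ) + m) * (m * Tu * Real.log m + m * n + n * b)) := by
  -- `3000 = 500 * 6`: the factor 500 from `htot`, the factor 6 from passing to the natural
  -- logarithm.
  refine ⟨3000, fun n m _ I Tu b hm hT1 hb hT hd => ?_⟩
  have hm1 : 1 ≤ m := by omega
  obtain ⟨k, hk, hfin, hmin⟩ := I.exists_finished hm1 hT1 hb hT hd
  have hspec := fun l => I.exec_spec hm1 hT1 hb hT hd l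
  refine ⟨k, I.start_config, fun l hl => ?_, ?_, hfin, ?_⟩
  · have hf := hmin l hl
    rw [(I.exec_succ l).1, if_neg hf]
    rw [ne_eq, MGYS.Instance.finished_val_iff] at hf
    exact ((hspec l).1.iterate (Nat.le_pow_clog (by norm_num) m) hm1 hT1 hb hT hd hf).2.2.1
  · exact (hspec k).1.alive_eq ((MGYS.Instance.finished_val_iff _).1 hfin)
  · have ht := (hspec k).2.1
    have he := (I.exec_succ k).2
    rw [if_pos hfin] at he
    have hn1 : 1 ≤ n := Nat.one_le_iff_ne_zero.2 (NeZero.ne n)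
    -- Rounding up to a power of two at most doubles the number of positions, so the initial trees
    -- have O(m) cells.
    have hpow : 2 ^ Nat.clog 2 m ≤ 2 * m := by
      have h1 := Nat.pow_pred_clog_lt_self (b := 2) (by norm_num) (show 1 < m by omega)
      have h2 : 2 ^ Nat.clog 2 m ≤ 2 ^ ((Nat.clog 2 m).pred + 1) :=
        Nat.pow_le_pow_right (by norm_num) (by rw [Nat.pred_eq_sub_one]; omega)
      rw [pow_succ] at h2
      omega
    have hs := I.start_time
    have hlog := MGYS.clog_add_one_le hm
    generalize Nat.clog 2 m = d at *
    set W := MGYS.Instance.workload n m Tu b d with hW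
    have hX : 1 ≤ Tu * (d + 1) := Nat.mul_pos hT1 (Nat.succ_pos d)
    have hmn : 1 ≤ m * n := Nat.mul_pos hm1 hn1
    have hW1 : 1 ≤ W := by rw [hW, MGYS.Instance.workload]; omega
    have hstart : I.start.time ≤ 100 * W := by
      have h1 : m ≤ m * (Tu * (d + 1)) := Nat.le_mul_of_pos_right m hX
      have h2 : n ≤ m * n := Nat.le_mul_of_pos_left n hm1
      have h3 : d + 1 ≤ m * Tu * (d + 1) :=
        Nat.le_mul_of_pos_left _ (Nat.mul_pos hm1 hT1)
      rw [hW, MGYS.Instance.workload]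
      rw [← mul_assoc] at h1
      rw [mul_comm n m] at hs
      omega
    have htot : (I.exec (k + 1)).time ≤ 500 * ((n + m) * W) := by
      have h1 : k * (200 * W + 2) ≤ (m + n) * (202 * W) :=
        Nat.mul_le_mul hk (by omega)
      have h2 : W ≤ (n + m) * W := Nat.le_mul_of_pos_left W (by omega)
      nlinarith
    have hWr : (W : ℝ) ≤ 6 * (m * Tu * Real.log m + m * n + n * b) := by
      have h1 : ((m : ℝ) * Tu) * (d + 1) ≤ (m * Tu) * (6 * Real.log m) :=
        mul_le_mul_of_nonneg_left hlog (by positivity)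
      have h2 : (0 : ℝ) ≤ m * n := by positivity
      have h3 : (0 : ℝ) ≤ n * b := by positivity
      rw [hW, MGYS.Instance.workload]
      push_cast
      linarith
    have htot' : ((I.exec (k + 1)).time : ℝ) ≤ 500 * (((n : ℝ) + m) * W) := by
      exact_mod_cast htot
    have : ((n : ℝ) + m) * W ≤
        ((n : ℝ) + m) * (6 * (m * Tu * Real.log m + m * n + n * b)) :=
      mul_le_mul_of_nonneg_left hWr (by positivity)
    linarith
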